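/- All graphs are finite and simple. A graph is \emph{planar} if it can be embedded in $\mathbb{R}^2$, and \emph{toroidal} if it can be embedded in the torus $T^2=S^1\times S^1$. A graph is \emph{nIL} (not intrinsically linked) if it has a piecewise linear embedding in $\mathbb{R}^3$ in which no two disjoint cycles form a nontrivial link, where a two-component link is trivial if its components are separated by a tamely embedded $2$-sphere (i.e. it is split). A graph is \emph{TN} if it is both toroidal and nIL. A graph $G$ is \emph{MTN} if it is TN and, for every pair of distinct non-adjacent vertices $u,v$, the graph $G+uv$ obtained by adding the edge $uv$ is not TN. Then no MTN graph of order $9$ is disconnected. Moreover, let $G$ be any TN graph of order $9$ whose vertex set is partitioned into two sets $S$ and $V(G)\setminus S$ with $1\le |S|\le 4$ and with no edge of $G$ joining $S$ to $V(G)\setminus S$. Then the subgraph of $G$ induced on $S$ is planar, and there exist vertices $a\in S$ and $b\in V(G)\setminus S$ such that $G+ab$ is TN. -/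

import Mathlib

namespace SpatialGraph

/-- A drawing of a finite graph `G` in a topological space `X` without crossings, i.e. an embedding
of `G` in `X`: distinct vertices are distinct points, every edge is an arc (the image of an
injective path) joining its two endpoints, an arc contains no vertices other than its endpoints,
and two different arcs meet only in common endpoints.
The value of `arc` is relevant only on edges of `G`. -/
structure Drawing {V : Type*} (G : SimpleGraph V) (X : Type*) [TopologicalSpace X] where
  point : V → X
  arc : Sym2 V → Set X
  point_injective : Function.Injective point
  arc_isArc : ∀ u v : V, G.Adj u v →
    ∃ γ : Path (point u) (point v), Function.Injective γ ∧ Set.range γ = arc s(u, v)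
  mem_of_point_mem_arc : ∀ e ∈ G.edgeSet, ∀ w : V, point w ∈ arc e → w ∈ e
  arc_inter_arc : ∀ e ∈ G.edgeSet, ∀ f ∈ G.edgeSet, e ≠ f →
    arc e ∩ arc f ⊆ point '' {w : V | w ∈ e ∧ w ∈ f}

/-- Euclidean three-space. -/
abbrev Space : Type := EuclideanSpace ℝ (Fin 3)

/-- The torus `ℝ/ℤ × ℝ/ℤ`. -/
abbrev Torus : Type := UnitAddCircle × UnitAddCircle

/-- `G` is planar: it can be embedded in the plane. -/
def IsPlanar {V : Type*} (G : SimpleGraph V) : Prop :=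
  Nonempty (Drawing G (EuclideanSpace ℝ (Fin 2)))

/-- `G` is toroidal: it can be embedded in the torus. -/
def IsToroidal {V : Type*} (G : SimpleGraph V) : Prop :=
  Nonempty (Drawing G Torus)

/-- A set in three-space is polygonal if it is a union of finitely many straight segments. -/
def IsPolygonal (S : Set Space) : Prop :=
  ∃ F : Finset (Space × Space), S = ⋃ p ∈ F, segment ℝ p.1 p.2

/-- The set `K` lies strictly inside, and `L` strictly outside, some tamely embedded 2-sphere
(the image of the unit sphere under a homeomorphism of three-space). -/
def SphereEncloses (K L : Set Space) : Prop :=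
  ∃ h : Space ≃ₜ Space,
    K ⊆ h '' Metric.ball 0 1 ∧ L ⊆ (h '' Metric.closedBall 0 1)ᶜ

/-- The two-component link `K ∪ L` is trivial (split): its components are separated by a 2-sphere.
A link is nontrivial if this fails. -/
def IsTrivialLink (K L : Set Space) : Prop :=
  SphereEncloses K L ∨ SphereEncloses L K

/-- The closed curve in `X` traced out by a closed walk (used for cycles) of `G`. -/
def Drawing.curve {V : Type*} {G : SimpleGraph V} {X : Type*} [TopologicalSpace X]
    (D : Drawing G X) {u : V} (c : G.Walk u u) : Set X :=
  ⋃ e ∈ c.edges, D.arc e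

/-- A spatial drawing is linkless if no two vertex-disjoint cycles form a nontrivial link. -/
def Drawing.IsLinkless {V : Type*} {G : SimpleGraph V} (D : Drawing G Space) : Prop :=
  ∀ (u v : V) (c : G.Walk u u) (d : G.Walk v v), c.IsCycle → d.IsCycle →
    c.support.Disjoint d.support → IsTrivialLink (D.curve c) (D.curve d)

/-- `G` is nIL (not intrinsically linked): it has a linkless embedding in three-space.
As usual in knot theory, embeddings in three-space are tame, here piecewise linear. -/
def IsNIL {V : Type*} (G : SimpleGraph V) : Prop :=
  ∃ D : Drawing G Space, (∀ e ∈ G.edgeSet, IsPolygonal (D.arc e)) ∧ D.IsLinkless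

/-- `G` is TN: toroidal and nIL. -/
def IsTN {V : Type*} (G : SimpleGraph V) : Prop :=
  IsToroidal G ∧ IsNIL G

/-- `G` is MTN (maximally TN): it is TN, and adding any edge of the complement destroys this. -/
def IsMTN {V : Type*} (G : SimpleGraph V) : Prop :=
  IsTN G ∧ ∀ u v : V, u ≠ v → ¬ G.Adj u v → ¬ IsTN (G ⊔ SimpleGraph.edge u v)

end SpatialGraph

/-! Let `S` have at most four vertices and no edges to its complement. Then adding any edge `ab`
with `a ∈ S`, `b ∉ S` preserves TN: erase the part of the drawing on `S`, and redraw it as part of a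
tiny copy of the complete graph of order 4 hanging from `b` on a short free arc `F`, which becomes
the new edge. Planarity on `S` comes from the same copy, and a disconnected graph of order 9 has
such an `S`, so it cannot be MTN.

The work lies in finding `F` (`IsPendant`). On the torus, edges are arbitrary topological arcs, so
it is not evident that free space can be reached from `b` by an arc. Instead of a Schoenflies
theorem, an edge `bc` serves as a guide. In a chart at `b`, its initial part is covered by balls
that miss the rest of the drawing and shrink towards `b`; thinning gives a chain in which only
consecutive balls meet (`exists_strictMono_ballChain`). The radical axes of consecutive balls cut
the chain into cells, through which two disjoint infinite polygons run to `b`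
(`BallChain.exists_disjoint_polygons`). One replaces the beginning of `bc`, the other is `F`, and a
free half-disc at the end of `F` holds the copy (`exists_isPendant`).

In space the drawing is polygonal, so a short segment from `b` in a direction parallel to none of
its segments is free, and the copy fits in a ball away from the old drawing
(`exists_isPendant_space`). The new edge is a bridge and lies on no cycle. Two disjoint cycles do
not both fit into `S`; a cycle in `S` is split from one outside by the small sphere; cycles outside
`S` are drawn as before. -/

namespace SpatialGraph

open Set Topology Filter

set_option linter.unusedSectionVars false

/-! ### Arcs -/

section Arcs

variable {X Y : Type*} [TopologicalSpace X] [TopologicalSpace Y]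

/-- `A` is an arc with endpoints `x` and `y`. -/
def IsArc (A : Set X) (x y : X) : Prop :=
  ∃ γ : Path x y, Function.Injective γ ∧ Set.range γ = A

theorem IsArc.right_mem {A : Set X} {x y : X} (h : IsArc A x y) : y ∈ A := by
  obtain ⟨γ, -, rfl⟩ := h
  exact ⟨1, γ.target⟩

theorem IsArc.isCompact {A : Set X} {x y : X} (h : IsArc A x y) : IsCompact A := by
  obtain ⟨γ, -, rfl⟩ := h
  exact isCompact_range γ.continuous

theorem IsArc.symm {A : Set X} {x y : X} (h : IsArc A x y) : IsArc A y x := by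
  obtain ⟨γ, hγ, rfl⟩ := h
  exact ⟨γ.symm, hγ.comp unitInterval.symm_bijective.injective, γ.symm_range⟩

theorem IsArc.map {A : Set X} {x y : X} (h : IsArc A x y) {f : X → Y} (hf : ContinuousOn f A)
    (hinj : InjOn f A) : IsArc (f '' A) (f x) (f y) := by
  obtain ⟨γ, hγ, rfl⟩ := h
  refine ⟨γ.map' hf, fun s t hst => hγ (hinj ⟨s, rfl⟩ ⟨t, rfl⟩ hst), ?_⟩
  rw [← range_comp]
  rfl

theorem IsArc.image_Icc {f : ℝ → X} {a b : ℝ} (hab : a < b) (hf : ContinuousOn f (Icc a b))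
    (hinj : InjOn f (Icc a b)) : IsArc (f '' Icc a b) (f a) (f b) := by
  have hI : IsArc (Icc a b) a b := by
    have hmap : ∀ t : unitInterval, a + (b - a) * (t : ℝ) ∈ Icc a b := fun t => by
      have h0 := t.2.1
      have h1 := t.2.2
      constructor <;> nlinarith
    refine ⟨⟨⟨fun t => a + (b - a) * (t : ℝ), by fun_prop⟩, by simp, by simp⟩, ?_, ?_⟩
    · intro s t hst
      have : (b - a) * (s : ℝ) = (b - a) * t := by simpa using hst
      exact Subtype.ext (mul_left_cancel₀ (sub_pos.2 hab).ne' this)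
    · ext x
      constructor
      · rintro ⟨t, rfl⟩
        exact hmap t
      · intro hx
        have hpos := sub_pos.2 hab
        refine ⟨⟨(x - a) / (b - a), div_nonneg (sub_nonneg.2 hx.1) hpos.le,
          (div_le_one hpos).2 (by linarith [hx.2])⟩, ?_⟩
        simp only [Path.coe_mk', ContinuousMap.coe_mk]
        field_simp
        ring
  exact hI.map hf hinj

theorem IsArc.trans {A B : Set X} {x y z : X} (hA : IsArc A x y) (hB : IsArc B y z)
    (h : A ∩ B ⊆ {y}) : IsArc (A ∪ B) x z := by
  obtain ⟨γ, hγ, rfl⟩ := hA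
  obtain ⟨δ, hδ, rfl⟩ := hB
  refine ⟨γ.trans δ, ?_, Path.trans_range γ δ⟩
  have key : ∀ s t : unitInterval, (s : ℝ) ≤ 1 / 2 → ¬ (t : ℝ) ≤ 1 / 2 →
      γ.trans δ s ≠ γ.trans δ t := by
    intro s t hs ht hst
    rw [Path.trans_apply, Path.trans_apply, dif_pos hs, dif_neg ht] at hst
    have h1 := h ⟨⟨_, rfl⟩, ⟨_, hst.symm⟩⟩
    rw [mem_singleton_iff, hst] at h1
    have : 2 * (t : ℝ) - 1 = 0 := congrArg Subtype.val (hδ (h1.trans δ.source.symm))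
    push Not at ht
    linarith
  intro s t hst
  by_cases hs : (s : ℝ) ≤ 1 / 2 <;> by_cases ht : (t : ℝ) ≤ 1 / 2
  · rw [Path.trans_apply, Path.trans_apply, dif_pos hs, dif_pos ht] at hst
    have := congrArg Subtype.val (hγ hst)
    exact Subtype.ext (by simpa using this)
  · exact absurd hst (key s t hs ht)
  · exact absurd hst.symm (key t s ht hs)
  · rw [Path.trans_apply, Path.trans_apply, dif_neg hs, dif_neg ht] at hst
    have := congrArg Subtype.val (hδ hst)
    exact Subtype.ext (by simpa using this)

theorem isArc_segment {E : Type*} [NormedAddCommGroup E] [NormedSpace ℝ E] {x y : E}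
    (h : x ≠ y) : IsArc (segment ℝ x y) x y := by
  have := IsArc.image_Icc (f := fun t : ℝ => AffineMap.lineMap x y t) zero_lt_one
    (by fun_prop) ((AffineMap.lineMap_injective ℝ h).injOn)
  simpa [segment_eq_image_lineMap] using this

end Arcs

/-! ### Infinite polygonal rays -/

section Rays

variable {E : Type*} [NormedAddCommGroup E] [NormedSpace ℝ E]

/-- The polygonal line with vertices `P 0, P 1, …`, parametrised by `[0, ∞)`. -/
noncomputable def polygon (P : ℕ → E) (t : ℝ) : E :=
  AffineMap.lineMap (P ⌊t⌋₊) (P (⌊t⌋₊ + 1)) (t - ⌊t⌋₊)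

/-- The closed right end matters: the floor jumps there, but both affine pieces take the value `P (k
+ 1)`. This makes the pieces glue continuously. -/
theorem polygon_eq (P : ℕ → E) {k : ℕ} {t : ℝ} (h : t ∈ Icc (k : ℝ) (k + 1)) :
    polygon P t = AffineMap.lineMap (P k) (P (k + 1)) (t - k) := by
  rcases h.2.eq_or_lt with h2 | h2
  · have : ⌊t⌋₊ = k + 1 := by
      rw [h2]
      exact_mod_cast Nat.floor_natCast (k + 1)
    rw [polygon, this, h2]
    simp
  · have : ⌊t⌋₊ = k := (Nat.floor_eq_iff ((Nat.cast_nonneg k).trans h.1)).2 ⟨h.1, h2⟩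
    rw [polygon, this]

theorem polygon_natCast (P : ℕ → E) (k : ℕ) : polygon P k = P k := by
  simp [polygon]

theorem polygon_mem_segment (P : ℕ → E) {t : ℝ} (ht : 0 ≤ t) :
    polygon P t ∈ segment ℝ (P ⌊t⌋₊) (P (⌊t⌋₊ + 1)) := by
  rw [segment_eq_image_lineMap]
  exact ⟨_, ⟨sub_nonneg.2 (Nat.floor_le ht), by linarith [(Nat.lt_floor_add_one t).le]⟩, rfl⟩

theorem continuousOn_polygon_Icc (P : ℕ → E) (n : ℕ) :
    ContinuousOn (polygon P) (Icc (0 : ℝ) n) := by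
  induction n with
  | zero =>
    simp
  | succ n ih =>
    have : Icc (0 : ℝ) ((n + 1 : ℕ) : ℝ) = Icc (0 : ℝ) n ∪ Icc (n : ℝ) (n + 1) := by
      rw [Icc_union_Icc_eq_Icc (Nat.cast_nonneg n) (by linarith)]
      push_cast
      rfl
    rw [this]
    refine ih.union_of_isClosed ?_ isClosed_Icc isClosed_Icc
    refine ContinuousOn.congr (f := fun t : ℝ => AffineMap.lineMap (P n) (P (n + 1)) (t - n))
      (by fun_prop) fun t ht => polygon_eq P ht

theorem continuousOn_polygon (P : ℕ → E) : ContinuousOn (polygon P) (Ici (0 : ℝ)) := by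
  intro t ht
  obtain ⟨n, hn⟩ := exists_nat_gt t
  have h := (continuousOn_polygon_Icc P n) t ⟨ht, hn.le⟩
  refine h.mono_of_mem_nhdsWithin ?_
  rw [← Ici_inter_Iic]
  exact inter_mem_nhdsWithin _ (Iic_mem_nhds hn)

theorem tendsto_polygon {P : ℕ → E} {x : E} (hP : Tendsto P atTop (𝓝 x)) :
    Tendsto (polygon P) atTop (𝓝 x) := by
  rw [Metric.tendsto_nhds] at hP ⊢
  intro ε hε
  have h1 := tendsto_nat_floor_atTop (α := ℝ) |>.eventually (hP ε hε)
  have h2 := tendsto_nat_floor_atTop (α := ℝ) |>.eventually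
    ((tendsto_add_atTop_nat 1).eventually (hP ε hε))
  filter_upwards [h1, h2, eventually_ge_atTop 0] with t h1 h2 ht
  exact (convex_ball x ε).segment_subset h1 h2 (polygon_mem_segment P ht)

/-- The substitution `t = s⁻¹ - 1` carries `(0, 1]` to `[0, ∞)`, and the limit `x` fills in `s = 0`.
-/
theorem isArc_polygon {P : ℕ → E} {x : E} (hP : Tendsto P atTop (𝓝 x))
    (hinj : InjOn (polygon P) (Ici 0)) (hx : ∀ t : ℝ, 0 ≤ t → polygon P t ≠ x) :
    IsArc (insert x (polygon P '' Ici 0)) x (P 0) := by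
  classical
  let f : ℝ → E := fun s => if s = 0 then x else polygon P (s⁻¹ - 1)
  have hf0 : f 0 = x := if_pos rfl
  have hf : ∀ s, s ≠ 0 → f s = polygon P (s⁻¹ - 1) := fun s hs => if_neg hs
  have hpos : ∀ s ∈ Ioc (0 : ℝ) 1, 0 ≤ s⁻¹ - 1 := fun s hs =>
    sub_nonneg.2 ((one_le_inv₀ hs.1).2 hs.2)
  have himg : f '' Icc 0 1 = insert x (polygon P '' Ici 0) := by
    ext y
    constructor
    · rintro ⟨s, hs, rfl⟩
      rcases hs.1.eq_or_lt with rfl | h0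
      · exact Or.inl hf0
      · exact Or.inr ⟨_, hpos s ⟨h0, hs.2⟩, (hf s h0.ne').symm⟩
    · rintro (rfl | ⟨t, ht, rfl⟩)
      · exact ⟨0, by simp, hf0⟩
      · have ht' : 0 < t + 1 := by linarith [mem_Ici.1 ht]
        refine ⟨(t + 1)⁻¹, ⟨by positivity, inv_le_one_of_one_le₀ (by linarith [mem_Ici.1 ht])⟩, ?_⟩
        rw [hf _ (inv_ne_zero ht'.ne'), inv_inv, add_sub_cancel_right]
  have hcont : ContinuousOn f (Icc 0 1) := by
    intro s hs
    rcases hs.1.eq_or_lt with rfl | h0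
    · have h1 : Tendsto f (𝓝[>] 0) (𝓝 x) := by
        have : Tendsto (fun s : ℝ => polygon P (s⁻¹ - 1)) (𝓝[>] 0) (𝓝 x) :=
          (tendsto_polygon hP).comp (tendsto_atTop_add_const_right _ (-1) tendsto_inv_nhdsGT_zero)
        refine this.congr' ?_
        filter_upwards [self_mem_nhdsWithin] with s hs using (hf s (ne_of_gt hs)).symm
      have h2 : ContinuousWithinAt f (Ioi 0) 0 := by
        rw [ContinuousWithinAt, hf0]
        exact h1
      exact (continuousWithinAt_insert_self.2 h2).mono fun s hs => by
        rcases hs.1.eq_or_lt with h | h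
        · exact Or.inl h.symm
        · exact Or.inr h
    · have h1 : ContinuousWithinAt (fun s : ℝ => polygon P (s⁻¹ - 1)) (Ioc 0 1) s := by
        refine ContinuousWithinAt.comp (g := polygon P) (f := fun s : ℝ => s⁻¹ - 1) (t := Ici 0)
          (continuousOn_polygon P _ (hpos s ⟨h0, hs.2⟩)) ?_ hpos
        exact ((continuousAt_inv₀ h0.ne').sub continuousAt_const).continuousWithinAt
      have h2 : ContinuousWithinAt f (Ioc 0 1) s :=
        h1.congr (fun y hy => hf y hy.1.ne') (hf s h0.ne')
      refine h2.mono_of_mem_nhdsWithin ?_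
      rw [← Ioi_inter_Iic, ← Ici_inter_Iic]
      filter_upwards [inter_mem_nhdsWithin _ (Ioi_mem_nhds h0)] with y hy
        using ⟨hy.2, hy.1.2⟩
  have hinj' : InjOn f (Icc 0 1) := by
    intro s hs t ht hst
    rcases hs.1.eq_or_lt with rfl | h0 <;> rcases ht.1.eq_or_lt with rfl | h1
    · rfl
    · rw [hf0, hf t h1.ne'] at hst
      exact absurd hst.symm (hx _ (hpos t ⟨h1, ht.2⟩))
    · rw [hf0, hf s h0.ne'] at hst
      exact absurd hst (hx _ (hpos s ⟨h0, hs.2⟩))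
    · rw [hf s h0.ne', hf t h1.ne'] at hst
      have := hinj (hpos s ⟨h0, hs.2⟩) (hpos t ⟨h1, ht.2⟩) hst
      simpa using this
  have := IsArc.image_Icc zero_lt_one hcont hinj'
  rw [himg, hf0, hf 1 one_ne_zero] at this
  rw [inv_one, sub_self] at this
  simpa using (polygon_natCast P 0) ▸ (Nat.cast_zero (R := ℝ)).symm ▸ this

end Rays

/-! ### Chains of balls and their power diagrams -/

section Chains

open Metric
open scoped RealInnerProductSpace

variable {E : Type*} [NormedAddCommGroup E] [InnerProductSpace ℝ E]

/-- The difference of the powers of a point with respect to two balls. It is an affine function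
whose zero set is the radical axis of the two balls. -/
def powerDiff (c c' : E) (r r' : ℝ) (y : E) : ℝ :=
  (‖y - c‖ ^ 2 - r ^ 2) - (‖y - c'‖ ^ 2 - r' ^ 2)

theorem powerDiff_sub (c c' : E) (r r' : ℝ) (x y : E) :
    powerDiff c c' r r' y - powerDiff c c' r r' x = 2 * ⟪c' - c, y - x⟫ := by
  simp only [powerDiff, norm_sub_sq_real, inner_sub_left, inner_sub_right, real_inner_comm c,
    real_inner_comm c']
  ring

theorem powerDiff_lineMap (c c' : E) (r r' : ℝ) (x y : E) (t : ℝ) :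
    powerDiff c c' r r' (AffineMap.lineMap x y t) =
      (1 - t) * powerDiff c c' r r' x + t * powerDiff c c' r r' y := by
  have h1 := powerDiff_sub c c' r r' x y
  have h2 := powerDiff_sub c c' r r' x (AffineMap.lineMap x y t)
  have h3 : (AffineMap.lineMap x y t : E) - x = t • (y - x) := by
    simp [AffineMap.lineMap_apply]
  rw [h3, inner_smul_right] at h2
  linear_combination h2 - t * h1

/-- The power of a point is negative inside a ball and nonnegative outside. -/
theorem powerDiff_neg_of_mem_ball {c c' : E} {r r' : ℝ} {y : E} (h : y ∈ ball c r)
    (h' : y ∉ ball c' r') (hr' : 0 < r') : powerDiff c c' r r' y < 0 := by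
  rw [mem_ball_iff_norm] at h h'
  have := norm_nonneg (y - c)
  rw [powerDiff]
  nlinarith

theorem powerDiff_neg_of_mem_closedBall {c c' : E} {r r' : ℝ} {y : E} (h : y ∈ closedBall c r)
    (h' : y ∉ closedBall c' r') (hr' : 0 < r') : powerDiff c c' r r' y < 0 := by
  rw [mem_closedBall_iff_norm] at h h'
  have := norm_nonneg (y - c)
  rw [powerDiff]
  nlinarith

theorem powerDiff_swap (c c' : E) (r r' : ℝ) (y : E) :
    powerDiff c' c r' r y = -powerDiff c c' r r' y := by
  rw [powerDiff, powerDiff]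
  ring

theorem mem_ball_of_powerDiff_eq_zero {c c' : E} {r r' : ℝ} {y : E}
    (h : powerDiff c c' r r' y = 0) (hy : y ∈ ball c r) (hr' : 0 < r') : y ∈ ball c' r' := by
  by_contra h'
  exact (powerDiff_neg_of_mem_ball hy h' hr').ne h

/-- A sequence of balls in which only consecutive ones meet. -/
structure BallChain (c : ℕ → E) (r : ℕ → ℝ) : Prop where
  pos : ∀ k, 0 < r k
  adj : ∀ k, dist (c k) (c (k + 1)) < r k + r (k + 1)
  sep : ∀ k l, k + 2 ≤ l → r k + r l ≤ dist (c k) (c l)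

/-- Greedy choice: from ball `n` jump to the last ball that meets it. A last one exists because the
balls shrink to `o`, which lies outside the closed ball `n`. Everything after it is separated from
ball `n`. -/
theorem exists_strictMono_ballChain {c : ℕ → E} {r : ℕ → ℝ} {o : E} (hr : ∀ n, 0 < r n)
    (hadj : ∀ n, dist (c n) (c (n + 1)) < r n + r (n + 1)) (hc : Tendsto c atTop (𝓝 o))
    (hr0 : Tendsto r atTop (𝓝 0)) (ho : ∀ n, r n < dist (c n) o) (j : ℕ) :
    ∃ φ : ℕ → ℕ, StrictMono φ ∧ φ 0 = j ∧ BallChain (c ∘ φ) (r ∘ φ) := by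
  classical
  have hnext : ∀ n, ∃ m, n < m ∧ dist (c n) (c m) < r n + r m ∧
      ∀ l, m < l → r n + r l ≤ dist (c n) (c l) := by
    intro n
    have h1 : Tendsto (fun m => dist (c n) (c m) - r m) atTop (𝓝 (dist (c n) o - 0)) :=
      (tendsto_const_nhds.dist hc).sub hr0
    rw [sub_zero] at h1
    obtain ⟨N, hN⟩ := eventually_atTop.1 (h1.eventually (lt_mem_nhds (ho n)))
    have hnN : n + 1 ≤ N + n + 1 := by omega
    refine ⟨Nat.findGreatest (fun m => dist (c n) (c m) < r n + r m) (N + n + 1), ?_, ?_, ?_⟩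
    · exact Nat.le_findGreatest hnN (hadj n)
    · exact Nat.findGreatest_spec (P := fun m => dist (c n) (c m) < r n + r m) hnN (hadj n)
    · intro l hl
      rcases le_or_gt l (N + n + 1) with h | h
      · exact not_lt.1 (Nat.findGreatest_is_greatest hl h)
      · linarith [hN l (by omega)]
  choose next hlt hmeet hmax using hnext
  have hmono : StrictMono fun k => next^[k] j := by
    refine strictMono_nat_of_lt_succ fun k => ?_
    rw [Function.iterate_succ_apply']
    exact hlt _
  refine ⟨fun k => next^[k] j, hmono, rfl, fun k => hr _, fun k => ?_, fun k l hkl => ?_⟩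
  · simp only [Function.comp, Function.iterate_succ_apply']
    exact hmeet _
  · refine hmax _ _ ?_
    have : next^[k + 1] j < next^[l] j := hmono (by omega)
    rwa [Function.iterate_succ_apply'] at this

namespace BallChain

variable {c : ℕ → E} {r : ℕ → ℝ}

/-- The power difference of consecutive balls of a chain. -/
def height (c : ℕ → E) (r : ℕ → ℝ) (k : ℕ) : E → ℝ :=
  powerDiff (c k) (c (k + 1)) (r k) (r (k + 1))

/-- The part of the `k`-th radical axis that lies in the balls `k` and `k + 1`. -/
def gate (c : ℕ → E) (r : ℕ → ℝ) (k : ℕ) : Set E :=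
  {y | y ∈ ball (c k) (r k) ∧ y ∈ ball (c (k + 1)) (r (k + 1)) ∧ height c r k y = 0}

theorem exists_mem_inter (h : BallChain c r) (k : ℕ) :
    ∃ y, y ∈ ball (c k) (r k) ∧ y ∈ ball (c (k + 1)) (r (k + 1)) := by
  have := (disjoint_ball_ball_iff (x := c k) (y := c (k + 1)) (h.pos k) (h.pos (k + 1))).not.2
    (not_le.2 (h.adj k))
  exact Set.not_disjoint_iff.1 this

theorem notMem_ball (h : BallChain c r) {k l : ℕ} (hkl : k + 2 ≤ l) {y : E}
    (hk : y ∈ ball (c k) (r k)) : y ∉ ball (c l) (r l) := fun hl =>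
  Set.disjoint_left.1 (ball_disjoint_ball (h.sep k l hkl)) hk hl

/-- A point of the balls `k + 1` and `k + 2` lies outside ball `k`, hence beyond the `k`-th radical
axis. In `height_neg` the same argument runs in the other direction. -/
theorem height_pos (h : BallChain c r) {k : ℕ} {y : E} (hy : y ∈ ball (c (k + 1)) (r (k + 1)))
    (hy' : y ∈ ball (c (k + 2)) (r (k + 2))) : 0 < height c r k y := by
  have := powerDiff_neg_of_mem_ball hy (fun hk => h.notMem_ball le_rfl hk hy') (h.pos k)
  rw [powerDiff_swap] at this
  exact neg_neg_iff_pos.1 this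

theorem height_neg (h : BallChain c r) {k : ℕ} {y : E} (hy : y ∈ ball (c k) (r k))
    (hy' : y ∈ ball (c (k + 1)) (r (k + 1))) : height c r (k + 1) y < 0 :=
  powerDiff_neg_of_mem_ball hy' (h.notMem_ball le_rfl hy) (h.pos _)

theorem gate_nonempty (h : BallChain c r) (k : ℕ) {u : E} (hu : u ∈ closedBall (c k) (r k))
    (hu' : height c r k u < 0) : (gate c r k).Nonempty := by
  obtain ⟨z, hz, hz'⟩ := h.exists_mem_inter k
  obtain ⟨w, hw, hw'⟩ := h.exists_mem_inter (k + 1)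
  have hw0 := h.height_pos hw hw'
  rcases le_total (height c r k z) 0 with hz0 | hz0
  · have hpos : 0 < height c r k w - height c r k z := by linarith
    let t := -height c r k z / (height c r k w - height c r k z)
    have ht : height c r k (AffineMap.lineMap z w t) = 0 := by
      rw [height, powerDiff_lineMap]
      simp only [t, height] at hpos ⊢
      field_simp
      ring
    have hmem : (AffineMap.lineMap z w t : E) ∈ ball (c (k + 1)) (r (k + 1)) :=
      (convex_ball _ _).lineMap_mem hz' hw
        ⟨div_nonneg (by linarith) hpos.le, (div_le_one hpos).2 (by linarith)⟩
    refine ⟨_, mem_ball_of_powerDiff_eq_zero (c := c (k + 1)) (r := r (k + 1)) ?_ hmem (h.pos k),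
      hmem, ht⟩
    rw [powerDiff_swap]
    exact neg_eq_zero.2 ht
  · have hpos : 0 < height c r k z - height c r k u := by linarith
    let t := -height c r k u / (height c r k z - height c r k u)
    have ht : height c r k (AffineMap.lineMap u z t) = 0 := by
      rw [height, powerDiff_lineMap]
      simp only [t, height] at hpos ⊢
      field_simp
      ring
    have ht0 : 0 < t := div_pos (by linarith) hpos
    have hmem : (AffineMap.lineMap u z t : E) ∈ ball (c k) (r k) := by
      have ht1 : t ≤ 1 := (div_le_one hpos).2 (by linarith)
      rcases ht1.eq_or_lt with h1 | h1
      · rw [h1]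
        simpa using hz
      · have := (convex_closedBall (c k) (r k)).openSegment_closure_interior_subset_interior
          (x := u) (y := z) (subset_closure hu)
          (by rw [interior_closedBall _ (h.pos k).ne']; exact hz)
        rw [interior_closedBall _ (h.pos k).ne'] at this
        exact this (lineMap_mem_openSegment ℝ u z ⟨ht0, h1⟩)
    exact ⟨_, hmem, mem_ball_of_powerDiff_eq_zero ht hmem (h.pos _), ht⟩

/-- Concentric balls would have constant height, but it is zero at `g` and positive in the next
overlap. -/
theorem center_ne (h : BallChain c r) (k : ℕ) {g : E} (hg : g ∈ gate c r k) :
    c k ≠ c (k + 1) := by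
  intro hc
  obtain ⟨w, hw, hw'⟩ := h.exists_mem_inter (k + 1)
  have h1 := powerDiff_sub (c k) (c (k + 1)) (r k) (r (k + 1)) g w
  rw [sub_eq_zero.2 hc.symm, inner_zero_left, mul_zero] at h1
  have := h.height_pos hw hw'
  have hg0 := hg.2.2
  rw [height] at this hg0
  linarith

/-- A gate is open within its radical axis, so a point of it can be moved a little orthogonally to
the line of centres. -/
theorem gate_nontrivial (h : BallChain c r) (hE : ∀ v : E, ∃ w ≠ 0, ⟪v, w⟫ = 0) (k : ℕ) {u : E}
    (hu : u ∈ closedBall (c k) (r k)) (hu' : height c r k u < 0) : (gate c r k).Nontrivial := by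
  obtain ⟨g, hg⟩ := h.gate_nonempty k hu hu'
  obtain ⟨w, hw0, hw⟩ := hE (c (k + 1) - c k)
  have hcont : Continuous fun t : ℝ => g + t • w := by fun_prop
  have hopen : ∀ᶠ t in 𝓝 (0 : ℝ), g + t • w ∈ ball (c k) (r k) ∩ ball (c (k + 1)) (r (k + 1)) := by
    refine hcont.continuousAt.eventually ((isOpen_ball.inter isOpen_ball).mem_nhds ?_)
    simpa using And.intro hg.1 hg.2.1
  obtain ⟨t, ht, ht0⟩ := ((hopen.filter_mono nhdsWithin_le_nhds).and
    (self_mem_nhdsWithin (s := {0}ᶜ))).exists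
  refine ⟨g, hg, g + t • w, ⟨ht.1, ht.2, ?_⟩, ?_⟩
  · have := powerDiff_sub (c k) (c (k + 1)) (r k) (r (k + 1)) g (g + t • w)
    rw [add_sub_cancel_left, inner_smul_right, hw] at this
    have hg0 := hg.2.2
    rw [height] at hg0 ⊢
    linarith
  · have : t • w ≠ 0 := smul_ne_zero ht0 hw0
    simpa using this

end BallChain

/-- Two points on a line and two points on another line can be joined in pairs by disjoint
segments, provided that each pair lies on one side of the other line. -/
theorem disjoint_segment_or_disjoint_segment {a b x y : E} {f g : E → ℝ}
    (hf : ∀ p q t, f (AffineMap.lineMap p q t) = (1 - t) * f p + t * f q)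
    (hg : ∀ p q t, g (AffineMap.lineMap p q t) = (1 - t) * g p + t * g q)
    (hab : a ≠ b) (hxy : x ≠ y) (fa : f a = 0) (fb : f b = 0) (fx : 0 < f x) (fy : 0 < f y)
    (gx : g x = 0) (gy : g y = 0) (ga : 0 < g a) (gb : 0 < g b) :
    Disjoint (segment ℝ a x) (segment ℝ b y) ∨ Disjoint (segment ℝ a y) (segment ℝ b x) := by
  by_contra! hcon
  obtain ⟨h1, h2⟩ := hcon
  rw [Set.not_disjoint_iff] at h1 h2
  simp only [segment_eq_image_lineMap] at h1 h2
  obtain ⟨_, ⟨s, hs, rfl⟩, ⟨t, ht, hst⟩⟩ := h1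
  obtain ⟨_, ⟨s', hs', rfl⟩, ⟨t', ht', hst'⟩⟩ := h2
  have e1 := congrArg f hst
  have e2 := congrArg g hst
  have e3 := congrArg f hst'
  have e4 := congrArg g hst'
  rw [hf, hf, fa, fb] at e1 e3
  rw [hg, hg, gx, gy] at e2 e4
  have hs0 : 0 < s := by
    rcases hs.1.eq_or_lt with rfl | h
    · have : t = 0 := by
        have : t * f y = 0 := by linarith
        exact (mul_eq_zero.1 this).resolve_right fy.ne'
      exact absurd (by simpa [this] using hst.symm) hab
    · exact h
  have hs0' : 0 < s' := by
    rcases hs'.1.eq_or_lt with rfl | h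
    · have : t' = 0 := by
        have : t' * f x = 0 := by linarith
        exact (mul_eq_zero.1 this).resolve_right fx.ne'
      exact absurd (by simpa [this] using hst'.symm) hab
    · exact h
  -- If both pairings cross, the values of `f` and `g` at the two crossing points give two bilinear
  -- relations between the parameters, from which the unknown values of `f` and `g` cancel. They
  -- force `s = t` and `s' = t'`.
  have h1 : t * t' = s * s' := by
    have : (t * t' - s * s') * (f x * f y) = 0 := by
      linear_combination t' * f x * e1 + s * f x * e3
    exact sub_eq_zero.1 ((mul_eq_zero.1 this).resolve_right (mul_pos fx fy).ne')
  have h2 : (1 - t) * (1 - s') = (1 - s) * (1 - t') := by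
    have : ((1 - t) * (1 - s') - (1 - s) * (1 - t')) * (g a * g b) = 0 := by
      linear_combination (1 - s') * g a * e2 - (1 - s) * g a * e4
    exact sub_eq_zero.1 ((mul_eq_zero.1 this).resolve_right (mul_pos ga gb).ne')
  have hst_eq : s = t := by
    have hs1 := hs.2
    have ht1 := ht.2
    have hs1' := hs'.2
    have ht1' := ht'.2
    have h3 : s * (s' - t') = (t - s) * t' := by linear_combination -h1
    have h4 : (t - s) * (1 - t') + (1 - t) * (s' - t') = 0 := by linear_combination -h2
    have h5 : (t - s) * (s * (1 - t') + (1 - t) * t') = 0 := by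
      linear_combination s * h4 - (1 - t) * h3
    rcases mul_eq_zero.1 h5 with h | h
    · linarith
    · have h6 : 0 ≤ s * (1 - t') := mul_nonneg hs0.le (by linarith)
      have h7 : 0 ≤ (1 - t) * t' := mul_nonneg (by linarith) ht'.1
      have h8 : t' = 1 := by
        have : s * (1 - t') = 0 := by linarith
        linarith [(mul_eq_zero.1 this).resolve_left hs0.ne']
      have h9 : t = 1 := by
        rw [h8] at h7 h
        linarith
      rw [h8, h9] at h1
      nlinarith
  subst hst_eq
  have hst_eq' : s' = t' := mul_left_cancel₀ hs0.ne' h1.symm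
  subst hst_eq'
  -- With equal parameters `a - b` is a nonnegative multiple of `y - x` or of its opposite,
  -- depending on the pairing, and both cannot happen unless `a = b` or `x = y`.
  have v1 : (1 - s) • (a - b) = s • (y - x) := by
    simp only [AffineMap.lineMap_apply_module] at hst
    linear_combination (norm := module) -hst
  have v2 : (1 - s') • (a - b) = s' • (x - y) := by
    simp only [AffineMap.lineMap_apply_module] at hst'
    linear_combination (norm := module) -hst'
  have v3 : (s' * (1 - s) + s * (1 - s')) • (a - b) = 0 := by
    linear_combination (norm := module) s' • v1 + s • v2
  have h3 := (smul_eq_zero.1 v3).resolve_right (sub_ne_zero.2 hab)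
  have h4 : s * (1 - s') = 0 := by
    nlinarith [mul_nonneg hs0'.le (sub_nonneg.2 hs.2), mul_nonneg hs0.le (sub_nonneg.2 hs'.2)]
  have h5 : 1 - s' = 0 := (mul_eq_zero.1 h4).resolve_left hs0.ne'
  rw [h5, zero_smul] at v2
  exact hxy (sub_eq_zero.1 ((smul_eq_zero.1 v2.symm).resolve_left hs0'.ne'))

namespace BallChain

variable {c : ℕ → E} {r : ℕ → ℝ}

/-- Heights are affine along an edge: the `k`-th rises from zero, the next one rises to zero. The
half-open cell obtained in this way lets a point determine the index of its edge. -/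
theorem polygon_mem_cell (h : BallChain c r) {P : ℕ → E} (hP : ∀ k, P k ∈ gate c r k) {t : ℝ}
    (ht : 0 ≤ t) : polygon P t ∈ ball (c (⌊t⌋₊ + 1)) (r (⌊t⌋₊ + 1)) ∧
      0 ≤ height c r ⌊t⌋₊ (polygon P t) ∧
      (height c r ⌊t⌋₊ (polygon P t) = 0 → polygon P t = P ⌊t⌋₊) ∧
      height c r (⌊t⌋₊ + 1) (polygon P t) < 0 := by
  have h0 : 0 ≤ t - ⌊t⌋₊ := sub_nonneg.2 (Nat.floor_le ht)
  have h1 : t - ⌊t⌋₊ < 1 := by linarith [Nat.lt_floor_add_one t]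
  rw [polygon]
  set k := ⌊t⌋₊
  set s := t - k
  have hk := hP k
  have hk' := hP (k + 1)
  have hpos := h.height_pos hk'.1 hk'.2.1
  have hneg := h.height_neg hk.1 hk.2.1
  have e1 : height c r k (AffineMap.lineMap (P k) (P (k + 1)) s) =
      s * height c r k (P (k + 1)) := by
    have := hk.2.2
    rw [height] at this ⊢
    rw [powerDiff_lineMap, this]
    ring
  have e2 : height c r (k + 1) (AffineMap.lineMap (P k) (P (k + 1)) s) =
      (1 - s) * height c r (k + 1) (P k) := by
    have := hk'.2.2
    rw [height] at this ⊢
    rw [powerDiff_lineMap, this]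
    ring
  refine ⟨(convex_ball _ _).lineMap_mem hk.2.1 hk'.1 ⟨h0, h1.le⟩, ?_, fun h2 => ?_, ?_⟩
  · rw [e1]
    exact mul_nonneg h0 hpos.le
  · rw [e1] at h2
    rw [(mul_eq_zero.1 h2).resolve_right hpos.ne', AffineMap.lineMap_apply_zero]
  · rw [e2]
    exact mul_neg_of_pos_of_neg (by linarith) hneg

/-- Neighbouring cells are told apart by the sign of the height between them, more distant ones by
disjointness of their balls. -/
theorem floor_eq_of_polygon_eq (h : BallChain c r) {P Q : ℕ → E} (hP : ∀ k, P k ∈ gate c r k)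
    (hQ : ∀ k, Q k ∈ gate c r k) {s t : ℝ} (hs : 0 ≤ s) (ht : 0 ≤ t)
    (hst : polygon P s = polygon Q t) : ⌊s⌋₊ = ⌊t⌋₊ := by
  wlog hlt : ⌊s⌋₊ < ⌊t⌋₊ generalizing s t P Q
  · rcases (not_lt.1 hlt).eq_or_lt with h1 | h1
    · exact h1.symm
    · exact (this hQ hP ht hs hst.symm h1).symm
  obtain ⟨h1, -, -, h2⟩ := h.polygon_mem_cell hP hs
  obtain ⟨h3, h4, -, -⟩ := h.polygon_mem_cell hQ ht
  rw [← hst] at h3 h4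
  rcases (Nat.succ_le_of_lt hlt).eq_or_lt with h5 | h5
  · rw [← h5] at h4
    exact absurd h4 (not_le.2 h2)
  · exact absurd h3 (h.notMem_ball (by omega) h1)

theorem injOn_polygon (h : BallChain c r) {P : ℕ → E} (hP : ∀ k, P k ∈ gate c r k) :
    InjOn (polygon P) (Ici 0) := by
  intro s hs t ht hst
  have hfl := h.floor_eq_of_polygon_eq hP hP hs ht hst
  rw [polygon, polygon, hfl] at hst
  have hne : P ⌊t⌋₊ ≠ P (⌊t⌋₊ + 1) := fun he => by
    have := h.height_pos (hP (⌊t⌋₊ + 1)).1 (hP (⌊t⌋₊ + 1)).2.1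
    rw [← he, (hP ⌊t⌋₊).2.2] at this
    exact lt_irrefl _ this
  have := AffineMap.lineMap_injective ℝ hne hst
  linarith

theorem tendsto_of_mem_gate {o : E} {P : ℕ → E} (hP : ∀ k, P k ∈ gate c r k)
    (hc : Tendsto c atTop (𝓝 o)) (hr : Tendsto r atTop (𝓝 0)) : Tendsto P atTop (𝓝 o) := by
  refine hc.congr_dist (squeeze_zero (fun _ => dist_nonneg) (fun k => ?_) hr)
  rw [dist_comm]
  exact (mem_ball.1 (hP k).1).le

/-- The two polygons are built gate by gate: pick two points in the next gate and exchange them if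
the segments would cross. The first gate has no ball before it, so `x` supplies the point on its
near side. -/
theorem exists_disjoint_polygons (h : BallChain c r) (hE : ∀ v : E, ∃ w ≠ 0, ⟪v, w⟫ = 0) {x : E}
    (hx : x ∈ closedBall (c 0) (r 0)) (hx' : x ∉ closedBall (c 1) (r 1)) :
    ∃ P Q : ℕ → E, (∀ k, P k ∈ gate c r k) ∧ (∀ k, Q k ∈ gate c r k) ∧
      ∀ k, Disjoint (segment ℝ (P k) (P (k + 1))) (segment ℝ (Q k) (Q (k + 1))) := by
  have hgate : ∀ k, (gate c r k).Nontrivial := by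
    rintro (_ | k)
    · exact h.gate_nontrivial hE 0 hx (powerDiff_neg_of_mem_closedBall hx hx' (h.pos _))
    · obtain ⟨u, hu, hu'⟩ := h.exists_mem_inter k
      exact h.gate_nontrivial hE (k + 1) (ball_subset_closedBall hu') (h.height_neg hu hu')
  let T : ℕ → Type _ := fun k => {p : E × E // p.1 ∈ gate c r k ∧ p.2 ∈ gate c r k ∧ p.1 ≠ p.2}
  have hstep : ∀ k (p : T k), ∃ q : T (k + 1),
      Disjoint (segment ℝ p.1.1 q.1.1) (segment ℝ p.1.2 q.1.2) := by
    rintro k ⟨⟨a, b⟩, ha, hb, hab⟩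
    obtain ⟨x, hx, y, hy, hxy⟩ := hgate (k + 1)
    have hg : ∀ p q t, -height c r (k + 1) (AffineMap.lineMap p q t) =
        (1 - t) * -height c r (k + 1) p + t * -height c r (k + 1) q := fun p q t => by
      rw [height, powerDiff_lineMap]
      ring
    rcases disjoint_segment_or_disjoint_segment (f := height c r k)
        (g := fun y => -height c r (k + 1) y) (powerDiff_lineMap _ _ _ _) hg hab hxy ha.2.2 hb.2.2
        (h.height_pos hx.1 hx.2.1) (h.height_pos hy.1 hy.2.1)
        (neg_eq_zero.2 hx.2.2) (neg_eq_zero.2 hy.2.2) (neg_pos.2 (h.height_neg ha.1 ha.2.1))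
        (neg_pos.2 (h.height_neg hb.1 hb.2.1)) with h1 | h1
    · exact ⟨⟨(x, y), hx, hy, hxy⟩, h1⟩
    · exact ⟨⟨(y, x), hy, hx, hxy.symm⟩, h1⟩
  choose next hnext using hstep
  obtain ⟨a, ha, b, hb, hab⟩ := hgate 0
  let S : ∀ k, T k := fun k => Nat.rec ⟨(a, b), ha, hb, hab⟩ next k
  exact ⟨fun k => (S k).1.1, fun k => (S k).1.2, fun k => (S k).2.1, fun k => (S k).2.2.1,
    fun k => hnext k (S k)⟩

/-- Along a chain of balls shrinking to a point `o` there are two arcs ending in `o` and disjoint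
otherwise. The first one starts in a prescribed point of the first ball, the second one starts in
a point `q` near which an open half-disc is disjoint from both arcs. -/
theorem exists_two_arcs (h : BallChain c r) (hE : ∀ v : E, ∃ w ≠ 0, ⟪v, w⟫ = 0) {o x : E}
    (hc : Tendsto c atTop (𝓝 o)) (hr : Tendsto r atTop (𝓝 0))
    (ho : ∀ k, o ∉ closedBall (c k) (r k)) (hx : x ∈ closedBall (c 0) (r 0))
    (hx' : ∀ k, x ∉ closedBall (c (k + 1)) (r (k + 1))) :
    ∃ (R F U : Set E) (q v : E), IsArc R o x ∧ IsArc F o q ∧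
      R ⊆ insert o (insert x (⋃ k, ball (c k) (r k))) ∧ F ⊆ insert o (⋃ k, ball (c k) (r k)) ∧
      R ∩ F ⊆ {o} ∧ IsOpen U ∧ q ∈ U ∧ U ⊆ ball (c 0) (r 0) ∧ v ≠ 0 ∧
      ∀ y ∈ U, 0 < ⟪v, y - q⟫ → y ∉ R ∧ y ∉ F := by
  obtain ⟨P, Q, hP, hQ, hPQ⟩ := h.exists_disjoint_polygons hE hx (hx' 0)
  have hball : ∀ {P : ℕ → E}, (∀ k, P k ∈ gate c r k) → ∀ t : ℝ, 0 ≤ t →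
      polygon P t ∈ ⋃ k, ball (c k) (r k) := fun hP t ht =>
    mem_iUnion.2 ⟨_, (h.polygon_mem_cell hP ht).1⟩
  have hne : ∀ {P : ℕ → E}, (∀ k, P k ∈ gate c r k) → ∀ t : ℝ, 0 ≤ t → polygon P t ≠ o := by
    intro P hP t ht heq
    obtain ⟨k, hk⟩ := mem_iUnion.1 (hball hP t ht)
    exact ho k (heq ▸ ball_subset_closedBall hk)
  have hxo : x ≠ o := fun heq => ho 0 (heq ▸ hx)
  have hdisj : ∀ s t : ℝ, 0 ≤ s → 0 ≤ t → polygon P s ≠ polygon Q t := by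
    intro s t hs ht hst
    have hfl := h.floor_eq_of_polygon_eq hP hQ hs ht hst
    have h1 := polygon_mem_segment P hs
    rw [hst, hfl] at h1
    exact Set.disjoint_left.1 (hPQ _) h1 (polygon_mem_segment Q ht)
  -- a point of a polygon that lies in the first ball or equals `x`, on the side of `x`
  have hfirst : ∀ {P : ℕ → E}, (∀ k, P k ∈ gate c r k) → ∀ t : ℝ, 0 ≤ t →
      (polygon P t ∈ ball (c 0) (r 0) ∨ polygon P t = x) → height c r 0 (polygon P t) ≤ 0 →
      height c r 0 (polygon P t) = 0 ∧ polygon P t = P 0 := by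
    intro P hP t ht h1 h2
    obtain ⟨h3, h4, h5, -⟩ := h.polygon_mem_cell hP ht
    rcases Nat.eq_zero_or_pos ⌊t⌋₊ with h0 | h0
    · rw [h0] at h4 h5
      exact ⟨le_antisymm h2 h4, h5 (le_antisymm h2 h4)⟩
    · rcases h1 with h1 | h1
      · exact absurd h3 (h.notMem_ball (by omega) h1)
      · rw [h1] at h3
        exact absurd (ball_subset_closedBall h3) (hx' _)
  have hx0 : height c r 0 x < 0 := powerDiff_neg_of_mem_closedBall hx (hx' 0) (h.pos 1)
  have hseg : ∀ y ∈ segment ℝ (P 0) x, (y ∈ ball (c 0) (r 0) ∨ y = x) ∧ height c r 0 y ≤ 0 ∧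
      (height c r 0 y = 0 → y = P 0) := by
    intro y hy
    rw [segment_eq_image_lineMap] at hy
    obtain ⟨t, ht, rfl⟩ := hy
    have e1 : height c r 0 (AffineMap.lineMap (P 0) x t) = t * height c r 0 x := by
      have := (hP 0).2.2
      rw [height] at this ⊢
      rw [powerDiff_lineMap, this]
      ring
    refine ⟨?_, ?_, fun h1 => ?_⟩
    · rcases ht.2.eq_or_lt with rfl | h1
      · right
        simp
      · left
        rcases ht.1.eq_or_lt with rfl | h0
        · simpa using (hP 0).1
        · have := (convex_closedBall (c 0) (r 0)).openSegment_interior_closure_subset_interior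
            (x := P 0) (y := x) (by rw [interior_closedBall _ (h.pos 0).ne']; exact (hP 0).1)
            (subset_closure hx)
          rw [interior_closedBall _ (h.pos 0).ne'] at this
          exact this (lineMap_mem_openSegment ℝ (P 0) x ⟨h0, h1⟩)
    · rw [e1]
      exact mul_nonpos_of_nonneg_of_nonpos ht.1 hx0.le
    · rw [e1] at h1
      rw [(mul_eq_zero.1 h1).resolve_right hx0.ne, AffineMap.lineMap_apply_zero]
  have hP0x : P 0 ≠ x := fun heq => by
    have := (hP 0).2.2
    rw [heq] at this
    exact hx0.ne this
  have hoseg : o ∉ segment ℝ (P 0) x := fun h1 => by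
    rcases (hseg o h1).1 with h2 | h2
    · exact ho 0 (ball_subset_closedBall h2)
    · exact hxo h2.symm
  have hRP := isArc_polygon (tendsto_of_mem_gate hP hc hr) (h.injOn_polygon hP) (hne hP)
  have hFQ := isArc_polygon (tendsto_of_mem_gate hQ hc hr) (h.injOn_polygon hQ) (hne hQ)
  -- Within the first ball both polygons stay on the far side of the first radical axis, meeting it
  -- at most in `P 0` and `Q 0`. The vector `c 0 - c 1` points to the near side, where only the
  -- segment from `P 0` to `x` has to be removed.
  refine ⟨insert o (polygon P '' Ici 0) ∪ segment ℝ (P 0) x, insert o (polygon Q '' Ici 0),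
    ball (c 0) (r 0) \ segment ℝ (P 0) x, Q 0, c 0 - c 1, hRP.trans (isArc_segment hP0x) ?_, hFQ,
    ?_, ?_, ?_, ?_, ⟨(hQ 0).1, ?_⟩, sdiff_subset, ?_, ?_⟩
  · rintro y ⟨rfl | ⟨t, ht, rfl⟩, hy⟩
    · exact absurd hy hoseg
    · obtain ⟨h1, h2, -⟩ := hseg _ hy
      exact (hfirst hP t ht h1 h2).2
  · rintro y ((rfl | ⟨t, ht, rfl⟩) | hy)
    · exact Or.inl rfl
    · exact Or.inr (Or.inr (hball hP t ht))
    · rcases (hseg y hy).1 with h1 | h1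
      · exact Or.inr (Or.inr (mem_iUnion.2 ⟨0, h1⟩))
      · exact Or.inr (Or.inl h1)
  · rintro y (rfl | ⟨t, ht, rfl⟩)
    · exact Or.inl rfl
    · exact Or.inr (hball hQ t ht)
  · rintro y ⟨hy, rfl | ⟨t, ht, rfl⟩⟩
    · rfl
    · exfalso
      rcases hy with (hy | ⟨s, hs, hy⟩) | hy
      · exact hne hQ t ht hy
      · exact hdisj s t hs ht hy
      · obtain ⟨h1, h2, h3⟩ := hseg _ hy
        have h4 := h3 (hfirst hQ t ht h1 h2).1
        have h5 := polygon_natCast P 0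
        rw [← h4, Nat.cast_zero] at h5
        exact hdisj 0 t le_rfl ht h5
  · refine isOpen_ball.sdiff ?_
    exact (isArc_segment hP0x).isCompact.isClosed
  · intro hy
    have h4 := (hseg _ hy).2.2 (hQ 0).2.2
    have h5 := polygon_natCast P 0
    rw [← h4, ← polygon_natCast Q 0] at h5
    exact hdisj _ _ (Nat.cast_nonneg _) (Nat.cast_nonneg _) h5
  · exact sub_ne_zero.2 (h.center_ne 0 (hP 0))
  · rintro y ⟨hy0, hys⟩ hy
    have hlt : height c r 0 y < 0 := by
      have h1 := powerDiff_sub (c 0) (c 1) (r 0) (r 1) (Q 0) y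
      have h2 := (hQ 0).2.2
      rw [← neg_sub (c 0), inner_neg_left] at h1
      rw [height] at h2 ⊢
      linarith
    have hpoly : ∀ {P : ℕ → E}, (∀ k, P k ∈ gate c r k) →
        y ∉ insert o (polygon P '' Ici 0) := by
      rintro P hP (rfl | ⟨t, ht, rfl⟩)
      · exact ho 0 (ball_subset_closedBall hy0)
      · exact hlt.ne (hfirst hP t ht (Or.inl hy0) hlt.le).1
    exact ⟨fun h1 => h1.elim (hpoly hP) hys, hpoly hQ⟩

end BallChain

/-- A path that leaves a closed set `C` at its start `σ 0` can be followed back to `σ 0` by steps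
that are short compared to the distance to `C`. -/
theorem exists_seq_tendsto_along_path {C : Set E} (hC : IsClosed C) {σ : ℝ → E}
    (hσ : ContinuousOn σ (Icc 0 1)) (h0 : σ 0 ∈ C) (hσC : ∀ t ∈ Ioo (0 : ℝ) 1, σ t ∉ C) :
    ∃ T : ℕ → ℝ, T 0 = 1 / 2 ∧ (∀ n, T n ∈ Ioc (0 : ℝ) (1 / 2)) ∧ Tendsto T atTop (𝓝 0) ∧
      ∀ n, dist (σ (T n)) (σ (T (n + 1))) ≤ infDist (σ (T n)) C / 2 := by
  have hpos : ∀ t ∈ Ioc (0 : ℝ) (1 / 2), 0 < infDist (σ t) C := fun t ht =>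
    (hC.notMem_iff_infDist_pos ⟨_, h0⟩).1 (hσC t ⟨ht.1, by linarith [ht.2]⟩)
  have hsub : ∀ {t : ℝ}, t ≤ 1 / 2 → Icc 0 t ⊆ Icc 0 1 := fun ht =>
    Icc_subset_Icc_right (by linarith)
  have hstep : ∀ t : Ioc (0 : ℝ) (1 / 2), ∃ s : Ioc (0 : ℝ) (1 / 2), s.1 < t.1 ∧
      dist (σ t) (σ s) ≤ infDist (σ t) C / 2 ∧
      ∀ u, 0 ≤ u → u < s.1 → infDist (σ t) C / 2 < dist (σ t) (σ u) := by
    rintro ⟨t, ht⟩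
    have hr := hpos t ht
    have hcomp : IsCompact (Icc 0 t ∩ σ ⁻¹' closedBall (σ t) (infDist (σ t) C / 2)) :=
      isCompact_Icc.of_isClosed_subset
        ((hσ.mono (hsub ht.2)).preimage_isClosed_of_isClosed isClosed_Icc isClosed_closedBall)
        inter_subset_left
    -- The least `s` is the first time the path is in the closed ball around `σ t`, so all earlier
    -- points are outside. It is positive because `σ 0 ∈ C` is at least twice the radius away.
    obtain ⟨s, ⟨hs, hs'⟩, hleast⟩ := hcomp.exists_isLeast
      ⟨t, ⟨ht.1.le, le_rfl⟩, mem_closedBall_self (by linarith)⟩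
    have hs0 : 0 < s := by
      rcases hs.1.eq_or_lt with rfl | h
      · have h1 := infDist_le_dist_of_mem (x := σ t) h0
        rw [mem_preimage, mem_closedBall, dist_comm] at hs'
        linarith
      · exact h
    have hst : s < t := by
      have hcw : ContinuousWithinAt σ (Ioo 0 t) t :=
        (hσ t ⟨ht.1.le, by linarith [ht.2]⟩).mono (Ioo_subset_Icc_self.trans (hsub ht.2))
      have hne : (𝓝[Ioo 0 t] t).NeBot := by
        rw [nhdsWithin_Ioo_eq_nhdsLT ht.1]
        infer_instance
      obtain ⟨u, hu, hu'⟩ := ((hcw.eventually (closedBall_mem_nhds (σ t) (half_pos hr))).and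
        self_mem_nhdsWithin).exists
      exact (hleast ⟨⟨hu'.1.le, hu'.2.le⟩, hu⟩).trans_lt hu'.2
    refine ⟨⟨s, hs0, hst.le.trans ht.2⟩, hst, by simpa [dist_comm] using hs', fun u hu hus => ?_⟩
    by_contra hcon
    refine absurd (hleast ⟨⟨hu, hus.le.trans hst.le⟩, ?_⟩) (not_le.2 hus)
    rw [mem_preimage, mem_closedBall, dist_comm]
    exact not_lt.1 hcon
  choose next hlt hdist hfar using hstep
  let T : ℕ → Ioc (0 : ℝ) (1 / 2) := fun n => next^[n] ⟨1 / 2, by norm_num, le_rfl⟩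
  have hT : ∀ n, T (n + 1) = next (T n) := fun n => Function.iterate_succ_apply' _ _ _
  have hanti : StrictAnti fun n => (T n : ℝ) := strictAnti_nat_of_succ_lt fun n => by
    rw [hT]
    exact hlt _
  have hbdd : BddBelow (range fun n => (T n : ℝ)) := ⟨0, by
    rintro _ ⟨n, rfl⟩
    exact (T n).2.1.le⟩
  have hlim := tendsto_atTop_ciInf hanti.antitone hbdd
  set l := ⨅ n, (T n : ℝ)
  have hl0 : 0 ≤ l := le_ciInf fun n => (T n).2.1.le
  have hl1 : ∀ n, l < T n := fun n => (ciInf_le hbdd (n + 1)).trans_lt (hanti n.lt_succ_self)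
  refine ⟨fun n => T n, rfl, fun n => (T n).2, ?_, fun n => ?_⟩
  · rcases hl0.eq_or_lt with h | h
    · rwa [← h] at hlim
    · exfalso
      have hlmem : l ∈ Ioc (0 : ℝ) (1 / 2) := ⟨h, (hl1 0).le⟩
      -- If the limit `l` were positive, `σ l` would be further from each `σ (T n)` than half the
      -- distance of `σ (T n)` to `C`. In the limit `σ l` would have distance 0 from `C`.
      have h1 : Tendsto (fun n => σ (T n)) atTop (𝓝 (σ l)) := by
        refine (hσ l ⟨h.le, by linarith [hlmem.2]⟩).tendsto.comp
          (tendsto_nhdsWithin_iff.2 ⟨hlim, Eventually.of_forall fun n => ?_⟩)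
        exact ⟨(T n).2.1.le, by linarith [(T n).2.2]⟩
      have h2 : Tendsto (fun n => infDist (σ (T n)) C / 2) atTop (𝓝 (infDist (σ l) C / 2)) :=
        (((continuous_infDist_pt C).tendsto _).comp h1).div_const 2
      have h3 := le_of_tendsto_of_tendsto h2 (h1.dist (tendsto_const_nhds (x := σ l)))
        (Eventually.of_forall fun n => (hfar (T n) l h.le (by rw [← hT]; exact hl1 _)).le)
      rw [dist_self] at h3
      linarith [hpos l hlmem]
  · simp only [hT]
    exact hdist _

/-- Let `σ` be an arc that starts in a point of a closed set `C` and then leaves `C`. Then the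
beginning of `σ` can be replaced so that there is a second arc `F` from `σ 0`, disjoint from
everything else, and its end `q` is a corner of a free half-disc. -/
theorem exists_two_arcs_along_path (hE : ∀ v : E, ∃ w ≠ 0, ⟪v, w⟫ = 0) {C : Set E}
    (hC : IsClosed C) {σ : ℝ → E} (hσ : ContinuousOn σ (Icc 0 1)) (hinj : InjOn σ (Icc 0 1))
    (h0 : σ 0 ∈ C) (hσC : ∀ t ∈ Ioo (0 : ℝ) 1, σ t ∉ C) :
    ∃ t ∈ Ioc (0 : ℝ) 1, ∃ (R F U : Set E) (q v : E), IsArc R (σ 0) (σ t) ∧ IsArc F (σ 0) q ∧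
      R ∩ C ⊆ {σ 0} ∧ F ∩ C ⊆ {σ 0} ∧ R ∩ σ '' Icc t 1 ⊆ {σ t} ∧ Disjoint F (σ '' Icc t 1) ∧
      R ∩ F ⊆ {σ 0} ∧ IsOpen U ∧ q ∈ U ∧ v ≠ 0 ∧
      ∀ y ∈ U, 0 < ⟪v, y - q⟫ → y ∉ C ∧ y ∉ σ '' Icc t 1 ∧ y ∉ R ∧ y ∉ F := by
  classical
  obtain ⟨T, hT0, hT, hTlim, hTdist⟩ := exists_seq_tendsto_along_path hC hσ h0 hσC
  let c : ℕ → E := fun n => σ (T n)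
  -- Half the distance keeps the closed balls off `C`, and the steps along the path are short enough
  -- for consecutive balls to meet.
  let r : ℕ → ℝ := fun n => infDist (c n) C / 2
  have hr : ∀ n, 0 < r n := fun n => half_pos
    ((hC.notMem_iff_infDist_pos ⟨_, h0⟩).1 (hσC _ ⟨(hT n).1, by linarith [(hT n).2]⟩))
  have hc : Tendsto c atTop (𝓝 (σ 0)) := by
    refine (hσ 0 (by simp)).tendsto.comp
      (tendsto_nhdsWithin_iff.2 ⟨hTlim, Eventually.of_forall fun n => ?_⟩)
    exact ⟨(hT n).1.le, by linarith [(hT n).2]⟩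
  have hr0 : Tendsto r atTop (𝓝 0) := by
    have := (((continuous_infDist_pt C).tendsto _).comp hc).div_const 2
    rwa [infDist_zero_of_mem h0, zero_div] at this
  have hCball : ∀ n, ∀ y ∈ closedBall (c n) (r n), y ∉ C := by
    intro n y hy hyC
    have h1 := infDist_le_dist_of_mem (x := c n) hyC
    rw [mem_closedBall, dist_comm] at hy
    have h2 := hr n
    simp only [r] at hy h2
    linarith
  have hadj : ∀ n, dist (c n) (c (n + 1)) < r n + r (n + 1) := fun n =>
    (hTdist n).trans_lt (lt_add_of_pos_right _ (hr _))
  have hro : ∀ n, r n < dist (c n) (σ 0) := fun n => by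
    by_contra hcon
    exact hCball n _ (by rw [mem_closedBall, dist_comm]; exact not_lt.1 hcon) h0
  -- only finitely many balls meet the final part of the path
  obtain ⟨N, hN⟩ : ∃ N, ∀ n, N ≤ n → ∀ t ∈ Icc (1 / 2 : ℝ) 1, σ t ∉ closedBall (c n) (r n) := by
    have hsub : Icc (1 / 2 : ℝ) 1 ⊆ Icc 0 1 := Icc_subset_Icc_left (by norm_num)
    have hcl : IsClosed (σ '' Icc (1 / 2 : ℝ) 1) :=
      (isCompact_Icc.image_of_continuousOn (hσ.mono hsub)).isClosed
    have hnot : σ 0 ∉ σ '' Icc (1 / 2 : ℝ) 1 := by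
      rintro ⟨t, ht, hteq⟩
      have := hinj (hsub ht) (by simp) hteq
      have := ht.1
      norm_num [*] at this
    obtain ⟨ε, hε, hball⟩ := Metric.isOpen_iff.1 hcl.isOpen_compl _ hnot
    have h1 : Tendsto (fun n => dist (c n) (σ 0) + r n) atTop (𝓝 (dist (σ 0) (σ 0) + 0)) :=
      (hc.dist tendsto_const_nhds).add hr0
    rw [dist_self, add_zero] at h1
    obtain ⟨N, hN⟩ := eventually_atTop.1 (h1.eventually (gt_mem_nhds hε))
    refine ⟨N, fun n hn t ht hmem => hball ?_ ⟨t, ht, rfl⟩⟩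
    rw [mem_ball]
    rw [mem_closedBall] at hmem
    linarith [hN n hn, dist_triangle (σ t) (c n) (σ 0)]
  have hcomp : IsCompact (⋃ n ∈ Finset.range N,
      Icc (1 / 2 : ℝ) 1 ∩ σ ⁻¹' closedBall (c n) (r n)) := by
    refine (Finset.range N).isCompact_biUnion fun n _ => ?_
    exact isCompact_Icc.of_isClosed_subset
      ((hσ.mono (Icc_subset_Icc_left (by norm_num))).preimage_isClosed_of_isClosed isClosed_Icc
        isClosed_closedBall) inter_subset_left
  have hmem : ∀ t ∈ Icc (1 / 2 : ℝ) 1, ∀ n, σ t ∈ closedBall (c n) (r n) →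
      t ∈ ⋃ n ∈ Finset.range N, Icc (1 / 2 : ℝ) 1 ∩ σ ⁻¹' closedBall (c n) (r n) := by
    intro t ht n hn
    refine mem_iUnion₂.2 ⟨n, Finset.mem_range.2 ?_, ht, hn⟩
    by_contra hcon
    exact hN n (not_lt.1 hcon) t ht hn
  -- Here `t` is the last time the path is in any of the closed balls; `1 / 2 = T 0` is such a time.
  -- Starting the chain at the last ball containing `σ t` then keeps the path after `t`, and `σ t`
  -- itself apart from that ball, away from the chain.
  obtain ⟨t, ht, htmax⟩ := hcomp.exists_isGreatest ⟨1 / 2, hmem _ (by norm_num) 0 (by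
    simp only [c, hT0]
    exact mem_closedBall_self (by simpa only [c, hT0] using (hr 0).le))⟩
  obtain ⟨n, hn, ht, htn⟩ := mem_iUnion₂.1 ht
  rw [Finset.mem_range] at hn
  have hlate : ∀ s ∈ Icc t 1, s ≠ t → ∀ n, σ s ∉ closedBall (c n) (r n) := fun s hs hst n hsn =>
    hst (le_antisymm (htmax (hmem s ⟨ht.1.trans hs.1, hs.2⟩ n hsn)) hs.1)
  let P : ℕ → Prop := fun n => σ t ∈ closedBall (c n) (r n)
  have hj := Nat.findGreatest_spec (P := P) hn.le htn
  have hj' : ∀ l, Nat.findGreatest P N < l → ¬ P l := fun l hl hPl => by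
    rcases le_total l N with h | h
    · exact Nat.findGreatest_is_greatest hl h hPl
    · exact hN l h t ht hPl
  set j := Nat.findGreatest P N
  obtain ⟨φ, hφ, hφ0, hchain⟩ := exists_strictMono_ballChain hr hadj hc hr0 hro j
  have htend := hφ.tendsto_atTop
  obtain ⟨R, F, U, q, v, hR, hF, hRsub, hFsub, hRF, hU, hqU, hUsub, hv, hfree⟩ :=
    hchain.exists_two_arcs hE (hc.comp htend) (hr0.comp htend)
      (fun k hk => hCball _ _ hk h0) (x := σ t) (by simp only [Function.comp, hφ0]; exact hj)
      (fun k => hj' _ (by rw [← hφ0]; exact hφ k.succ_pos))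
  have ht0 : 0 < t := by linarith [ht.1]
  have htI : t ∈ Icc (0 : ℝ) 1 := ⟨ht0.le, ht.2⟩
  have hne : ∀ s ∈ Icc t 1, σ s ≠ σ 0 := fun s hs h => by
    have := hinj ⟨ht0.le.trans hs.1, hs.2⟩ (by simp) h
    linarith [hs.1]
  have hballs : ∀ s ∈ Icc t 1, σ s ∈ ⋃ k, ball ((c ∘ φ) k) ((r ∘ φ) k) → s = t := by
    intro s hs hmem
    obtain ⟨k, hk⟩ := mem_iUnion.1 hmem
    by_contra hst
    exact hlate s hs hst _ (ball_subset_closedBall hk)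
  have hballC : ∀ y ∈ ⋃ k, ball ((c ∘ φ) k) ((r ∘ φ) k), y ∉ C := by
    intro y hy
    obtain ⟨k, hk⟩ := mem_iUnion.1 hy
    exact hCball _ _ (ball_subset_closedBall hk)
  have htF : σ t ∉ F := fun h => hne t ⟨le_rfl, ht.2⟩ (hRF ⟨hR.right_mem, h⟩)
  refine ⟨t, ⟨ht0, ht.2⟩, R, F, U, q, v, hR, hF, ?_, ?_, ?_, ?_, hRF, hU, hqU, hv, ?_⟩
  · rintro y ⟨hy, hyC⟩
    rcases hRsub hy with h | h | h
    · exact h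
    · exact absurd hyC (h ▸ hCball j _ hj)
    · exact absurd hyC (hballC y h)
  · rintro y ⟨hy, hyC⟩
    rcases hFsub hy with h | h
    · exact h
    · exact absurd hyC (hballC y h)
  · rintro _ ⟨hy, s, hs, rfl⟩
    rcases hRsub hy with h | h | h
    · exact absurd h (hne s hs)
    · exact h
    · rw [hballs s hs h]
      rfl
  · rw [Set.disjoint_left]
    rintro _ hy ⟨s, hs, rfl⟩
    rcases hFsub hy with h | h
    · exact hne s hs h
    · exact htF (hballs s hs h ▸ hy)
  · intro y hy hyv
    obtain ⟨hyR, hyF⟩ := hfree y hy hyv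
    refine ⟨hballC y (mem_iUnion.2 ⟨0, hUsub hy⟩), ?_, hyR, hyF⟩
    rintro ⟨s, hs, rfl⟩
    rw [hballs s hs (mem_iUnion.2 ⟨0, hUsub hy⟩)] at hyR
    exact hyR hR.right_mem

end Chains

/-! ### Drawings -/

namespace Drawing

variable {V W X Y : Type*} [TopologicalSpace X] [TopologicalSpace Y] {G : SimpleGraph V}

/-- The set of all points covered by a drawing. -/
def carrier (D : Drawing G X) : Set X :=
  range D.point ∪ ⋃ e ∈ G.edgeSet, D.arc e

theorem point_mem_carrier (D : Drawing G X) (v : V) : D.point v ∈ D.carrier :=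
  Or.inl ⟨v, rfl⟩

theorem arc_subset_carrier (D : Drawing G X) {e : Sym2 V} (he : e ∈ G.edgeSet) :
    D.arc e ⊆ D.carrier := fun _ hx => Or.inr (mem_iUnion₂.2 ⟨e, he, hx⟩)

theorem isArc (D : Drawing G X) {u v : V} (h : G.Adj u v) :
    IsArc (D.arc s(u, v)) (D.point u) (D.point v) :=
  D.arc_isArc u v h

theorem isCompact_arc (D : Drawing G X) {e : Sym2 V} (he : e ∈ G.edgeSet) :
    IsCompact (D.arc e) := by
  induction e with | _ u v
  exact (D.isArc he).isCompact

theorem isClosed_carrier [T2Space X] [Finite V] (D : Drawing G X) : IsClosed D.carrier :=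
  (finite_range _).isClosed.union
    ((toFinite G.edgeSet).isClosed_biUnion fun _ he => (D.isCompact_arc he).isClosed)

/-- The image of a drawing under a map that is continuous and injective on it. -/
def map (D : Drawing G X) (f : X → Y) (hf : ContinuousOn f D.carrier)
    (hinj : InjOn f D.carrier) : Drawing G Y where
  point v := f (D.point v)
  arc e := f '' D.arc e
  point_injective u v huv :=
    D.point_injective (hinj (D.point_mem_carrier u) (D.point_mem_carrier v) huv)
  arc_isArc u v huv :=
    (D.isArc huv).map (hf.mono (D.arc_subset_carrier huv)) (hinj.mono (D.arc_subset_carrier huv))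
  mem_of_point_mem_arc := by
    rintro e he w ⟨x, hx, hxw⟩
    rw [hinj (D.arc_subset_carrier he hx) (D.point_mem_carrier w) hxw] at hx
    exact D.mem_of_point_mem_arc e he w hx
  arc_inter_arc := by
    rintro e he e' he' hne _ ⟨⟨x, hx, rfl⟩, y, hy, hxy⟩
    rw [hinj (D.arc_subset_carrier he' hy) (D.arc_subset_carrier he hx) hxy] at hy
    obtain ⟨w, hw, rfl⟩ := D.arc_inter_arc e he e' he' hne ⟨hx, hy⟩
    exact ⟨w, hw, rfl⟩

theorem carrier_map (D : Drawing G X) (f : X → Y) (hf : ContinuousOn f D.carrier)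
    (hinj : InjOn f D.carrier) : (D.map f hf hinj).carrier = f '' D.carrier := by
  rw [carrier, carrier, image_union, image_iUnion₂, ← range_comp]
  rfl

/-- The restriction of a drawing to a subgraph. -/
def comap (D : Drawing G X) {H : SimpleGraph W} (f : H →g G) (hf : Function.Injective f) :
    Drawing H X where
  point v := D.point (f v)
  arc e := D.arc (e.map f)
  point_injective := D.point_injective.comp hf
  arc_isArc u v huv := D.arc_isArc _ _ (f.map_adj huv)
  mem_of_point_mem_arc e he w hw := by
    obtain ⟨v, hv, hvw⟩ := Sym2.mem_map.1 (D.mem_of_point_mem_arc _ (f.map_mem_edgeSet he) _ hw)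
    exact hf hvw ▸ hv
  arc_inter_arc e he e' he' hne := by
    rintro x hx
    obtain ⟨w, ⟨hw, hw'⟩, rfl⟩ := D.arc_inter_arc _ (f.map_mem_edgeSet he) _
      (f.map_mem_edgeSet he') (fun h => hne (Sym2.map.injective hf h)) hx
    obtain ⟨v, hv, rfl⟩ := Sym2.mem_map.1 hw
    obtain ⟨v', hv', hvv⟩ := Sym2.mem_map.1 hw'
    exact ⟨v, ⟨hv, hf hvv ▸ hv'⟩, rfl⟩

end Drawing

/-! ### A straight-line drawing of the complete graph on four vertices -/

/-- The positions of the vertices in a straight-line drawing of the complete graph of order 4. -/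
noncomputable def tetraPoint : Fin 4 → EuclideanSpace ℝ (Fin 2) :=
  ![!₂[0, 0], !₂[3, 3], !₂[3, -3], !₂[2, 0]]

/-- The edges in a straight-line drawing of the complete graph of order 4. -/
noncomputable def tetraArc : Sym2 (Fin 4) → Set (EuclideanSpace ℝ (Fin 2)) :=
  Sym2.lift ⟨fun u v => segment ℝ (tetraPoint u) (tetraPoint v), fun _ _ => segment_symm ℝ _ _⟩

theorem mem_segment_plane {x y z : EuclideanSpace ℝ (Fin 2)} (h : z ∈ segment ℝ x y) :
    ∃ t ∈ Icc (0 : ℝ) 1, z 0 = x 0 + t * (y 0 - x 0) ∧ z 1 = x 1 + t * (y 1 - x 1) := by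
  rw [segment_eq_image'] at h
  obtain ⟨t, ht, rfl⟩ := h
  exact ⟨t, ht, by simp, by simp⟩

/-- Twice the signed area of a triangle. -/
def signedArea (x y z : EuclideanSpace ℝ (Fin 2)) : ℝ :=
  (y 0 - x 0) * (z 1 - x 1) - (y 1 - x 1) * (z 0 - x 0)

theorem notMem_segment_of_signedArea_ne_zero {x y z : EuclideanSpace ℝ (Fin 2)}
    (h : signedArea x y z ≠ 0) : z ∉ segment ℝ x y := fun hz => by
  obtain ⟨t, -, h0, h1⟩ := mem_segment_plane hz
  apply h
  rw [signedArea, h0, h1]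
  ring

theorem segment_inter_segment_of_signedArea_ne_zero {x y z : EuclideanSpace ℝ (Fin 2)}
    (h : signedArea x y z ≠ 0) : segment ℝ x y ∩ segment ℝ x z ⊆ {x} := by
  rintro p ⟨hp, hp'⟩
  obtain ⟨s, -, h0, h1⟩ := mem_segment_plane hp
  obtain ⟨t, -, h0', h1'⟩ := mem_segment_plane hp'
  have hs : s = 0 := by
    have : s * signedArea x y z = 0 := by
      rw [signedArea]
      linear_combination (z 1 - x 1) * (h0' - h0) - (z 0 - x 0) * (h1' - h1)
    exact (mul_eq_zero.1 this).resolve_right h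
  rw [hs] at h0 h1
  ext i
  fin_cases i
  · simpa using h0
  · simpa using h1

/-- General position settles everything except disjoint edges: the points are distinct, edges avoid
other vertices, and adjacent edges meet only in their common vertex. -/
theorem signedArea_tetraPoint_ne_zero {u v w : Fin 4} (huv : u ≠ v) (huw : u ≠ w) (hvw : v ≠ w) :
    signedArea (tetraPoint u) (tetraPoint v) (tetraPoint w) ≠ 0 := by
  fin_cases u <;> fin_cases v <;> fin_cases w <;>
    first
      | exact absurd rfl huv
      | exact absurd rfl huw
      | exact absurd rfl hvw
      | norm_num [signedArea, tetraPoint]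

/-- Up to symmetry only the three perfect matchings have to be checked, each by linear arithmetic in
coordinates. -/
theorem disjoint_tetraArc {u v w z : Fin 4} (huv : u ≠ v) (huw : u ≠ w) (huz : u ≠ z)
    (hvw : v ≠ w) (hvz : v ≠ z) (hwz : w ≠ z) : Disjoint (tetraArc s(u, v)) (tetraArc s(w, z)) := by
  have h1 : Disjoint (tetraArc s(0, 1)) (tetraArc s(2, 3)) := by
    rw [Set.disjoint_left]
    intro p hp hp'
    obtain ⟨s, hs, h0, h1⟩ := mem_segment_plane hp
    obtain ⟨t, ht, h0', h1'⟩ := mem_segment_plane hp'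
    simp [tetraPoint] at h0 h1 h0' h1'
    linarith [hs.1, hs.2, ht.1, ht.2]
  have h2 : Disjoint (tetraArc s(0, 2)) (tetraArc s(1, 3)) := by
    rw [Set.disjoint_left]
    intro p hp hp'
    obtain ⟨s, hs, h0, h1⟩ := mem_segment_plane hp
    obtain ⟨t, ht, h0', h1'⟩ := mem_segment_plane hp'
    simp [tetraPoint] at h0 h1 h0' h1'
    linarith [hs.1, hs.2, ht.1, ht.2]
  have h3 : Disjoint (tetraArc s(0, 3)) (tetraArc s(1, 2)) := by
    rw [Set.disjoint_left]
    intro p hp hp'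
    obtain ⟨s, hs, h0, h1⟩ := mem_segment_plane hp
    obtain ⟨t, ht, h0', h1'⟩ := mem_segment_plane hp'
    simp [tetraPoint] at h0 h1 h0' h1'
    linarith [hs.1, hs.2, ht.1, ht.2]
  have key : ∀ u v w z : Fin 4, u ≠ v → u ≠ w → u ≠ z → v ≠ w → v ≠ z → w ≠ z →
      (s(u, v) = s(0, 1) ∧ s(w, z) = s(2, 3)) ∨ (s(u, v) = s(2, 3) ∧ s(w, z) = s(0, 1)) ∨
      (s(u, v) = s(0, 2) ∧ s(w, z) = s(1, 3)) ∨ (s(u, v) = s(1, 3) ∧ s(w, z) = s(0, 2)) ∨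
      (s(u, v) = s(0, 3) ∧ s(w, z) = s(1, 2)) ∨ (s(u, v) = s(1, 2) ∧ s(w, z) = s(0, 3)) := by
    decide
  rcases key u v w z huv huw huz hvw hvz hwz with
    ⟨h, h'⟩ | ⟨h, h'⟩ | ⟨h, h'⟩ | ⟨h, h'⟩ | ⟨h, h'⟩ | ⟨h, h'⟩ <;> rw [h, h']
  exacts [h1, h1.symm, h2, h2.symm, h3, h3.symm]

theorem tetraPoint_injective : Function.Injective tetraPoint := by
  intro u v huv
  by_contra hne
  have hthird : ∀ u v : Fin 4, ∃ w, u ≠ w ∧ v ≠ w := by decide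
  obtain ⟨w, hw, hw'⟩ := hthird u v
  refine signedArea_tetraPoint_ne_zero hne hw hw' ?_
  rw [huv, signedArea]
  ring

/-- A straight-line drawing of the complete graph of order 4 in the plane. -/
noncomputable def tetraDrawing :
    Drawing (⊤ : SimpleGraph (Fin 4)) (EuclideanSpace ℝ (Fin 2)) where
  point := tetraPoint
  arc := tetraArc
  point_injective := tetraPoint_injective
  arc_isArc u v huv := isArc_segment (tetraPoint_injective.ne huv)
  mem_of_point_mem_arc e he w hw := by
    induction e with | _ u v
    have huv : u ≠ v := he
    rw [Sym2.mem_iff]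
    by_contra! hcon
    exact notMem_segment_of_signedArea_ne_zero
      (signedArea_tetraPoint_ne_zero huv hcon.1.symm hcon.2.symm) hw
  arc_inter_arc e he f hf hne := by
    have share : ∀ u v w : Fin 4, u ≠ v → u ≠ w → s(u, v) ≠ s(u, w) →
        tetraArc s(u, v) ∩ tetraArc s(u, w) ⊆
          tetraPoint '' {x | x ∈ s(u, v) ∧ x ∈ s(u, w)} := by
      intro u v w huv huw hne p hp
      have hvw : v ≠ w := fun h => hne (by rw [h])
      refine ⟨u, by simp, ?_⟩
      exact (segment_inter_segment_of_signedArea_ne_zero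
        (signedArea_tetraPoint_ne_zero huv huw hvw) hp).symm
    induction e with | _ u v
    induction f with | _ w z
    have huv : u ≠ v := he
    have hwz : w ≠ z := hf
    by_cases h1 : u = w
    · subst h1
      exact share _ _ _ huv hwz hne
    by_cases h2 : u = z
    · subst h2
      rw [Sym2.eq_swap (a := w)] at hne ⊢
      exact share _ _ _ huv hwz.symm hne
    by_cases h3 : v = w
    · subst h3
      rw [Sym2.eq_swap (a := u)] at hne ⊢
      exact share _ _ _ huv.symm hwz hne
    by_cases h4 : v = z
    · subst h4
      rw [Sym2.eq_swap (a := u), Sym2.eq_swap (a := w)] at hne ⊢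
      exact share _ _ _ huv.symm hwz.symm hne
    rw [(disjoint_tetraArc huv h1 h2 h3 h4 hwz).inter_eq]
    exact empty_subset _

/-- The drawing lies in an open half-plane except for vertex 0, which is on the boundary line. After
scaling it therefore fits into a half-disc centred at that vertex. -/
theorem mem_carrier_tetraDrawing {p : EuclideanSpace ℝ (Fin 2)} (hp : p ∈ tetraDrawing.carrier) :
    (p = 0 ∨ 0 < p 0) ∧ |p 0| ≤ 3 ∧ |p 1| ≤ 3 := by
  have h : ∃ u v : Fin 4, p ∈ segment ℝ (tetraPoint u) (tetraPoint v) := by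
    rcases hp with ⟨v, rfl⟩ | hp
    · exact ⟨v, v, left_mem_segment ℝ _ _⟩
    · obtain ⟨e, -, hpe⟩ := mem_iUnion₂.1 hp
      induction e with | _ u v
      exact ⟨u, v, hpe⟩
  obtain ⟨u, v, hp⟩ := h
  have hb : ∀ u, (u = 0 ∨ 0 < tetraPoint u 0) ∧ |tetraPoint u 0| ≤ 3 ∧ |tetraPoint u 1| ≤ 3 := by
    intro u
    fin_cases u <;> norm_num [tetraPoint]
  have hz : tetraPoint 0 = 0 := by
    ext i
    fin_cases i <;> simp [tetraPoint]
  obtain ⟨t, ht, h0, h1⟩ := mem_segment_plane hp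
  obtain ⟨hu, hu0, hu1⟩ := hb u
  obtain ⟨hv, hv0, hv1⟩ := hb v
  rw [abs_le] at hu0 hu1 hv0 hv1 ⊢
  rw [abs_le]
  have ht0 := ht.1
  have ht1 := sub_nonneg.2 ht.2
  refine ⟨?_, ⟨by nlinarith, by nlinarith⟩, ⟨by nlinarith, by nlinarith⟩⟩
  rcases ht0.eq_or_lt with rfl | ht0
  · have hpu : p = tetraPoint u := by
      ext i
      fin_cases i
      · simpa using h0
      · simpa using h1
    rw [hpu]
    exact hu.imp (fun h => by rw [h, hz]) id
  rcases ht1.eq_or_lt with h | ht1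
  · have : t = 1 := by linarith
    have hpv : p = tetraPoint v := by
      ext i
      fin_cases i
      · simpa [this] using h0
      · simpa [this] using h1
    rw [hpv]
    exact hv.imp (fun h => by rw [h, hz]) id
  have h0' : p 0 = (1 - t) * tetraPoint u 0 + t * tetraPoint v 0 := by linarith
  rcases hu with rfl | hu <;> rcases hv with rfl | hv
  · left
    rw [hz] at hp
    simpa using hp
  · right
    rw [h0', hz]
    simpa using mul_pos ht0 hv
  · right
    rw [h0', hz]
    simpa using mul_pos ht1 hu
  · right
    rw [h0']
    exact add_pos (mul_pos ht1 hu) (mul_pos ht0 hv)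

/-! ### Small copies of the complete graph of order 4 in half-discs -/

section Blob

open scoped RealInnerProductSpace

variable {E : Type*} [NormedAddCommGroup E] [InnerProductSpace ℝ E]

/-- Any half-disc contains a straight-line drawing of the complete graph of order 4 with a vertex
in the centre. -/
theorem exists_drawing_in_half_disc (hE : ∀ v : E, ∃ w ≠ 0, ⟪v, w⟫ = 0) {U : Set E} (hU : IsOpen U)
    {q v : E} (hq : q ∈ U) (hv : v ≠ 0) :
    ∃ B : Drawing (⊤ : SimpleGraph (Fin 4)) E, B.point 0 = q ∧
      (∀ y ∈ B.carrier, y = q ∨ y ∈ U ∧ 0 < ⟪v, y - q⟫) ∧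
      ∀ e, ∃ x y, B.arc e = segment ℝ x y := by
  obtain ⟨w, hw, hvw⟩ := hE v
  obtain ⟨ε, hε, hball⟩ := Metric.isOpen_iff.1 hU q hq
  -- The factors 3 are the coordinate bounds of the model drawing, so scaling by `η` brings it into
  -- the ball of radius `ε`.
  obtain ⟨η, hη, hη'⟩ : ∃ η : ℝ, 0 < η ∧ η * (3 * ‖v‖ + 3 * ‖w‖) < ε := by
    have hpos : 0 < 3 * ‖v‖ + 3 * ‖w‖ := by
      have := norm_pos_iff.2 hv
      positivity
    refine ⟨ε / (3 * ‖v‖ + 3 * ‖w‖) / 2, by positivity, ?_⟩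
    field_simp
    linarith
  have hvv : 0 < ⟪v, v⟫ := real_inner_self_pos.2 hv
  have hww : 0 < ⟪w, w⟫ := real_inner_self_pos.2 hw
  let f : EuclideanSpace ℝ (Fin 2) → E := fun p => q + η • (p 0 • v + p 1 • w)
  have hfv : ∀ p, ⟪v, f p - q⟫ = η * (p 0 * ⟪v, v⟫) := fun p => by
    simp only [f, add_sub_cancel_left, inner_smul_right, inner_add_right, hvw]
    ring
  have hfw : ∀ p, ⟪w, f p - q⟫ = η * (p 1 * ⟪w, w⟫) := fun p => by
    simp only [f, add_sub_cancel_left, inner_smul_right, inner_add_right,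
      (real_inner_comm v w).trans hvw]
    ring
  have hinj : Function.Injective f := by
    intro p p' hpp
    have h0 := hfv p
    have h1 := hfw p
    rw [hpp, hfv] at h0
    rw [hpp, hfw] at h1
    ext i
    fin_cases i
    · exact (mul_right_cancel₀ hvv.ne' (mul_left_cancel₀ hη.ne' h0)).symm
    · exact (mul_right_cancel₀ hww.ne' (mul_left_cancel₀ hη.ne' h1)).symm
  have hcont : Continuous f := by
    simp only [f]
    fun_prop
  have hf0 : f 0 = q := by simp [f]
  refine ⟨tetraDrawing.map f hcont.continuousOn hinj.injOn, ?_, ?_, ?_⟩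
  · rw [← hf0]
    refine congrArg f ?_
    ext i
    fin_cases i <;> simp [tetraDrawing, tetraPoint]
  · rw [Drawing.carrier_map]
    rintro _ ⟨p, hp, rfl⟩
    obtain ⟨h1, h2, h3⟩ := mem_carrier_tetraDrawing hp
    rcases h1 with rfl | h1
    · exact Or.inl hf0
    · refine Or.inr ⟨hball ?_, ?_⟩
      · rw [mem_ball_iff_norm]
        simp only [f, add_sub_cancel_left]
        refine lt_of_le_of_lt ?_ hη'
        rw [norm_smul, Real.norm_of_nonneg hη.le]
        refine mul_le_mul_of_nonneg_left ((norm_add_le _ _).trans ?_) hη.le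
        rw [norm_smul, norm_smul, Real.norm_eq_abs, Real.norm_eq_abs]
        gcongr
      · rw [hfv]
        positivity
  · intro e
    induction e with | _ a b
    refine ⟨f (tetraPoint a), f (tetraPoint b), ?_⟩
    change f '' segment ℝ _ _ = _
    rw [segment_eq_image', segment_eq_image', image_image]
    refine image_congr fun t _ => ?_
    simp only [f, PiLp.add_apply, PiLp.smul_apply, PiLp.sub_apply, smul_eq_mul]
    module

end Blob

/-! ### Room for a pendant graph at a vertex of a drawing in a surface -/

section Pendant

open scoped RealInnerProductSpace

theorem IsArc.ne {X : Type*} [TopologicalSpace X] {A : Set X} {x y : X} (h : IsArc A x y) :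
    x ≠ y := by
  obtain ⟨γ, hγ, -⟩ := h
  intro hxy
  have : γ 0 = γ 1 := by rw [γ.source, γ.target, hxy]
  exact zero_ne_one (hγ this)

theorem IsArc.exists_param {X : Type*} [TopologicalSpace X] {A : Set X} {x y : X}
    (h : IsArc A x y) : ∃ f : ℝ → X, Continuous f ∧ InjOn f (Icc 0 1) ∧ f 0 = x ∧ f 1 = y ∧
      f '' Icc 0 1 = A := by
  obtain ⟨γ, hγ, rfl⟩ := h
  refine ⟨γ.extend, γ.continuous_extend, fun s hs t ht hst => ?_, γ.extend_zero, γ.extend_one, ?_⟩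
  · rw [γ.extend_apply hs, γ.extend_apply ht] at hst
    exact congrArg Subtype.val (hγ hst)
  · ext z
    constructor
    · rintro ⟨t, ht, rfl⟩
      exact ⟨⟨t, ht⟩, (γ.extend_apply ht).symm⟩
    · rintro ⟨t, rfl⟩
      exact ⟨t, t.2, γ.extend_apply t.2⟩

theorem exists_ne_zero_inner_eq_zero {E : Type*} [NormedAddCommGroup E] [InnerProductSpace ℝ E]
    [FiniteDimensional ℝ E] (hE : 1 < Module.finrank ℝ E) (v : E) : ∃ w ≠ 0, ⟪v, w⟫ = 0 := by
  have h : LinearMap.ker (innerₛₗ ℝ v) ≠ ⊥ := by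
    apply LinearMap.ker_ne_bot_of_finrank_lt
    simpa using hE
  obtain ⟨w, hw, hw0⟩ := (Submodule.ne_bot_iff _).1 h
  exact ⟨w, hw0, hw⟩

/-- The half-disc at `q` is taken in the direction `q - o`, pointing away from the segment. -/
theorem exists_drawing_at_end_of_segment {E : Type*} [NormedAddCommGroup E]
    [InnerProductSpace ℝ E] (hE : ∀ v : E, ∃ w ≠ 0, ⟪v, w⟫ = 0) {C : Set E} (hC : IsClosed C)
    {o q : E} (hq : q ≠ o) (hoq : segment ℝ o q ∩ C ⊆ {o}) {ε : ℝ} (hε : 0 < ε) :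
    ∃ B : Drawing (⊤ : SimpleGraph (Fin 4)) E, B.point 0 = q ∧
      (∀ e, ∃ x y, B.arc e = segment ℝ x y) ∧ segment ℝ o q ∩ B.carrier ⊆ {q} ∧
      Disjoint B.carrier C ∧ B.carrier ⊆ Metric.ball q ε := by
  have hqC : q ∉ C := fun h => hq (hoq ⟨right_mem_segment ℝ o q, h⟩)
  obtain ⟨B, hB0, hB, hBseg⟩ := exists_drawing_in_half_disc hE
    (hC.isOpen_compl.inter (Metric.isOpen_ball (x := q) (ε := ε))) (q := q) (v := q - o)
    ⟨hqC, Metric.mem_ball_self hε⟩ (sub_ne_zero.2 hq)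
  refine ⟨B, hB0, hBseg, ?_, ?_, ?_⟩
  · rintro y ⟨hy, hyB⟩
    rcases hB y hyB with h | ⟨-, h⟩
    · exact h
    · exfalso
      rw [segment_eq_image'] at hy
      obtain ⟨t, ht, rfl⟩ := hy
      have h1 : o + t • (q - o) - q = (t - 1) • (q - o) := by module
      rw [h1, inner_smul_right] at h
      exact not_le.2 h (mul_nonpos_of_nonpos_of_nonneg (by linarith [ht.2]) real_inner_self_nonneg)
  · rw [Set.disjoint_left]
    intro y hy hyC
    rcases hB y hy with rfl | ⟨h, -⟩
    · exact hqC hyC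
    · exact h.1 hyC
  · intro y hy
    rcases hB y hy with rfl | ⟨h, -⟩
    · exact Metric.mem_ball_self hε
    · exact h.2

namespace Drawing

variable {V X : Type*} [TopologicalSpace X] {G : SimpleGraph V}

open Classical in
/-- Replace the arc of one edge of a drawing. -/
noncomputable def reroute (D : Drawing G X) {b c : V} (A : Set X)
    (hA : IsArc A (D.point b) (D.point c)) (hpoint : ∀ w, D.point w ∈ A → w ∈ s(b, c))
    (harc : ∀ e ∈ G.edgeSet, e ≠ s(b, c) → A ∩ D.arc e ⊆ {D.point b, D.point c}) :
    Drawing G X where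
  point := D.point
  arc := Function.update D.arc s(b, c) A
  point_injective := D.point_injective
  arc_isArc u v huv := by
    by_cases h : s(u, v) = s(b, c)
    · rw [h, Function.update_self]
      rcases Sym2.eq_iff.1 h with ⟨rfl, rfl⟩ | ⟨rfl, rfl⟩
      · exact hA
      · exact hA.symm
    · rw [Function.update_of_ne h]
      exact D.isArc huv
  mem_of_point_mem_arc e he w hw := by
    by_cases h : e = s(b, c)
    · rw [h, Function.update_self] at hw
      exact h ▸ hpoint w hw
    · rw [Function.update_of_ne h] at hw
      exact D.mem_of_point_mem_arc e he w hw
  arc_inter_arc := by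
    have key : ∀ e ∈ G.edgeSet, e ≠ s(b, c) →
        A ∩ D.arc e ⊆ D.point '' {w | w ∈ s(b, c) ∧ w ∈ e} := by
      intro e he hne y hy
      rcases harc e he hne hy with h | h
      · exact ⟨b, ⟨Sym2.mem_mk_left b c, D.mem_of_point_mem_arc e he b (h ▸ hy.2)⟩, h.symm⟩
      · exact ⟨c, ⟨Sym2.mem_mk_right b c, D.mem_of_point_mem_arc e he c (h ▸ hy.2)⟩, h.symm⟩
    intro e he f hf hne
    by_cases h : e = s(b, c) <;> by_cases h' : f = s(b, c)
    · exact absurd (h.trans h'.symm) hne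
    · rw [h, Function.update_self, Function.update_of_ne h']
      exact key f hf h'
    · rw [h', Function.update_self, Function.update_of_ne h, inter_comm]
      simpa only [and_comm] using key e he h
    · rw [Function.update_of_ne h, Function.update_of_ne h']
      exact D.arc_inter_arc e he f hf hne

theorem carrier_reroute_subset (D : Drawing G X) {b c : V} (A : Set X)
    (hA : IsArc A (D.point b) (D.point c)) (hpoint : ∀ w, D.point w ∈ A → w ∈ s(b, c))
    (harc : ∀ e ∈ G.edgeSet, e ≠ s(b, c) → A ∩ D.arc e ⊆ {D.point b, D.point c}) :
    (D.reroute A hA hpoint harc).carrier ⊆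
      A ∪ (range D.point ∪ ⋃ e ∈ G.edgeSet \ {s(b, c)}, D.arc e) := by
  classical
  rintro y (hy | hy)
  · exact Or.inr (Or.inl hy)
  · obtain ⟨e, he, hy⟩ := mem_iUnion₂.1 hy
    by_cases h : e = s(b, c)
    · simp only [reroute, h, Function.update_self] at hy
      exact Or.inl hy
    · simp only [reroute, Function.update_of_ne h] at hy
      exact Or.inr (Or.inr (mem_iUnion₂.2 ⟨e, ⟨he, h⟩, hy⟩))

end Drawing

/-- The arcs and drawings needed to attach a graph of order at most 4 to the vertex `b` of a
drawing by an edge. -/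
structure IsPendant {V X : Type*} [TopologicalSpace X] {G : SimpleGraph V} (D : Drawing G X)
    (b : V) (B : Drawing (⊤ : SimpleGraph (Fin 4)) X) (F : Set X) : Prop where
  isArc : IsArc F (D.point b) (B.point 0)
  inter_left : F ∩ D.carrier ⊆ {D.point b}
  inter_right : F ∩ B.carrier ⊆ {B.point 0}
  disjoint : Disjoint B.carrier D.carrier

/-- A drawing in a surface has, up to a change of a single edge at `b`, room for a pendant graph
at the vertex `b`. -/
theorem exists_isPendant {V X : Type*} [Finite V] [TopologicalSpace X] [T2Space X]
    {G : SimpleGraph V}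
    (hX : ∀ x : X, ∃ φ : EuclideanSpace ℝ (Fin 2) → X, IsOpenEmbedding φ ∧ φ 0 = x)
    (D : Drawing G X) (b : V) :
    ∃ (D' : Drawing G X) (B : Drawing (⊤ : SimpleGraph (Fin 4)) X) (F : Set X),
      IsPendant D' b B F := by
  have hE : ∀ v : EuclideanSpace ℝ (Fin 2), ∃ w ≠ 0, ⟪v, w⟫ = 0 :=
    exists_ne_zero_inner_eq_zero (by simp)
  obtain ⟨φ, hφ, hφ0⟩ := hX (D.point b)
  by_cases hb : ∃ c, G.Adj b c
  · obtain ⟨c, hbc⟩ := hb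
    obtain ⟨f, hf, hfinj, hf0, hf1, hfA⟩ := (D.isArc hbc).exists_param
    -- The part up to `a` lies in the chart, and `a < 1` keeps it from reaching `c`.
    obtain ⟨a, ha0, ha1, haφ⟩ : ∃ a : ℝ, 0 < a ∧ a < 1 ∧ ∀ t ∈ Icc 0 a, f t ∈ range φ := by
      have : ∀ᶠ t in 𝓝 (0 : ℝ), f t ∈ range φ :=
        hf.continuousAt.eventually (hφ.isOpen_range.mem_nhds ⟨0, hφ0.trans hf0.symm⟩)
      obtain ⟨ε, hε, hball⟩ := Metric.eventually_nhds_iff.1 this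
      refine ⟨min (ε / 2) (1 / 2), by positivity, by
        linarith [min_le_right (ε / 2) (1 / 2)], fun t ht => hball ?_⟩
      rw [Real.dist_eq, sub_zero, abs_of_nonneg ht.1]
      linarith [ht.2, min_le_left (ε / 2) (1 / 2)]
    let σ : ℝ → EuclideanSpace ℝ (Fin 2) := fun t => Function.invFun φ (f (a * t))
    have hmul : ∀ t ∈ Icc (0 : ℝ) 1, a * t ∈ Icc 0 a := fun t ht =>
      ⟨mul_nonneg ha0.le ht.1, mul_le_of_le_one_right ha0.le ht.2⟩
    have hmul' : ∀ t ∈ Icc (0 : ℝ) 1, a * t ∈ Icc (0 : ℝ) 1 := fun t ht =>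
      Icc_subset_Icc_right ha1.le (hmul t ht)
    have hσφ : ∀ t ∈ Icc (0 : ℝ) 1, φ (σ t) = f (a * t) := fun t ht =>
      Function.invFun_eq (haφ _ (hmul t ht))
    have hσ : ContinuousOn σ (Icc 0 1) := by
      rw [hφ.isInducing.continuousOn_iff]
      exact ContinuousOn.congr (f := fun t => f (a * t)) (by fun_prop) hσφ
    have hσinj : InjOn σ (Icc 0 1) := by
      intro s hs t ht hst
      have h1 := congrArg φ hst
      rw [hσφ s hs, hσφ t ht] at h1
      exact mul_left_cancel₀ ha0.ne' (hfinj (hmul' s hs) (hmul' t ht) h1)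
    have hσ0 : φ (σ 0) = D.point b := by rw [hσφ 0 (by simp), mul_zero, hf0]
    -- The construction has to avoid `K`, which is the drawing without the guiding arc, and the rest
    -- `f '' Icc a 1` of that arc. The beginning of the arc may be given up.
    set K : Set X := range D.point ∪ ⋃ e ∈ G.edgeSet \ {s(b, c)}, D.arc e with hK
    have hKcl : IsClosed (K ∪ f '' Icc a 1) :=
      ((finite_range _).isClosed.union ((toFinite (G.edgeSet \ {s(b, c)})).isClosed_biUnion
        fun _ he => (D.isCompact_arc he.1).isClosed)).union
        (isCompact_Icc.image hf).isClosed
    have hcross : ∀ t ∈ Icc (0 : ℝ) 1, f t ∈ K → f t = D.point b ∨ f t = D.point c := by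
      intro t ht htK
      have htA : f t ∈ D.arc s(b, c) := hfA ▸ ⟨t, ht, rfl⟩
      rcases htK with ⟨w, hw⟩ | htK
      · rw [← hw] at htA ⊢
        rcases Sym2.mem_iff.1 (D.mem_of_point_mem_arc _ hbc w htA) with rfl | rfl
        · exact Or.inl rfl
        · exact Or.inr rfl
      · obtain ⟨e, he, hte⟩ := mem_iUnion₂.1 htK
        obtain ⟨w, ⟨hw, -⟩, hwt⟩ := D.arc_inter_arc _ hbc e he.1 (Ne.symm he.2) ⟨htA, hte⟩
        rw [← hwt]
        rcases Sym2.mem_iff.1 hw with rfl | rfl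
        · exact Or.inl rfl
        · exact Or.inr rfl
    obtain ⟨t, ht, R, F, U, q, v, hR, hF, hRC, hFC, hRσ, hFσ, hRF, hU, hqU, hv, hfree⟩ :=
      exists_two_arcs_along_path hE (hKcl.preimage hφ.continuous) hσ hσinj
        (by rw [mem_preimage, hσ0]; exact Or.inl (Or.inl ⟨b, rfl⟩))
        (fun t ht => by
          have htI := Ioo_subset_Icc_self ht
          have hat : a * t ∈ Ioo 0 a := ⟨mul_pos ha0 ht.1, mul_lt_of_lt_one_right ha0 ht.2⟩
          rw [mem_preimage, hσφ t htI]
          rintro (h | ⟨s, hs, hst⟩)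
          · rcases hcross _ (hmul' t htI) h with h | h
            · rw [← hf0] at h
              exact hat.1.ne' (hfinj (hmul' t htI) (by simp) h)
            · rw [← hf1] at h
              linarith [hfinj (hmul' t htI) (by simp) h, hat.2]
          · linarith [hfinj ⟨ha0.le.trans hs.1, hs.2⟩ (hmul' t htI) hst, hs.1, hat.2])
    have htI : t ∈ Icc (0 : ℝ) 1 := Ioc_subset_Icc_self ht
    have hat0 : 0 < a * t := mul_pos ha0 ht.1
    have hat1 : a * t < 1 := (mul_le_of_le_one_right ha0.le ht.2).trans_lt ha1
    -- the remaining part of the old arc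
    have htail : ∀ y, φ y ∈ f '' Icc (a * t) 1 →
        y ∈ σ '' Icc t 1 ∨ y ∈ φ ⁻¹' (K ∪ f '' Icc a 1) := by
      rintro y ⟨s, hs, hsy⟩
      rcases le_total s a with h | h
      · left
        have hs1 : s / a ∈ Icc t 1 :=
          ⟨by rw [le_div_iff₀ ha0, mul_comm]; exact hs.1, (div_le_one ha0).2 h⟩
        refine ⟨s / a, hs1, hφ.injective ?_⟩
        rw [hσφ _ ⟨ht.1.le.trans hs1.1, hs1.2⟩, mul_div_cancel₀ _ ha0.ne', hsy]
      · right
        exact Or.inr ⟨s, ⟨h, hs.2⟩, hsy⟩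
    have hb_tail : D.point b ∉ f '' Icc (a * t) 1 := by
      rintro ⟨s, hs, hsb⟩
      rw [← hf0] at hsb
      linarith [hfinj ⟨hat0.le.trans hs.1, hs.2⟩ (by simp) hsb, hs.1]
    have hA : IsArc (φ '' R ∪ f '' Icc (a * t) 1) (D.point b) (D.point c) := by
      have h1 := hR.map hφ.continuous.continuousOn hφ.injective.injOn
      have h2 := IsArc.image_Icc hat1 hf.continuousOn
        (hfinj.mono (Icc_subset_Icc_left hat0.le))
      rw [hσ0, hσφ t htI] at h1
      rw [hf1] at h2
      refine h1.trans h2 ?_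
      rintro _ ⟨⟨y, hy, rfl⟩, hy'⟩
      rcases htail y hy' with h | h
      · rw [hRσ ⟨hy, h⟩, hσφ t htI]
        rfl
      · rw [hRC ⟨hy, h⟩, hσ0] at hy'
        exact absurd hy' hb_tail
    have hAK : (φ '' R ∪ f '' Icc (a * t) 1) ∩ K ⊆ {D.point b, D.point c} := by
      rintro y ⟨⟨z, hz, rfl⟩ | ⟨s, hs, rfl⟩, hyK⟩
      · left
        rw [hRC ⟨hz, Or.inl hyK⟩, hσ0]
      · exact hcross s ⟨hat0.le.trans hs.1, hs.2⟩ hyK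
    have hpoint : ∀ w, D.point w ∈ φ '' R ∪ f '' Icc (a * t) 1 → w ∈ s(b, c) := by
      intro w hw
      rw [Sym2.mem_iff]
      exact (hAK ⟨hw, Or.inl ⟨w, rfl⟩⟩).imp (fun h => D.point_injective h)
        (fun h => D.point_injective h)
    have harc : ∀ e ∈ G.edgeSet, e ≠ s(b, c) →
        (φ '' R ∪ f '' Icc (a * t) 1) ∩ D.arc e ⊆ {D.point b, D.point c} :=
      fun e he hne y hy => hAK ⟨hy.1, Or.inr (mem_iUnion₂.2 ⟨e, ⟨he, hne⟩, hy.2⟩)⟩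
    obtain ⟨B, hB0, hB, -⟩ := exists_drawing_in_half_disc hE hU hqU hv
    have hq : q ≠ σ 0 := hF.ne.symm
    have hBfree : ∀ y ∈ B.carrier, y ∉ φ ⁻¹' (K ∪ f '' Icc a 1) ∧ y ∉ σ '' Icc t 1 ∧ y ∉ R ∧
        (y ∈ F → y = q) := by
      intro y hy
      rcases hB y hy with rfl | ⟨hyU, hyv⟩
      · exact ⟨fun h => hq (hFC ⟨hF.right_mem, h⟩),
          Set.disjoint_left.1 hFσ hF.right_mem, fun h => hq (hRF ⟨h, hF.right_mem⟩), fun _ => rfl⟩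
      · obtain ⟨h1, h2, h3, h4⟩ := hfree y hyU hyv
        exact ⟨h1, h2, h3, fun h => absurd h h4⟩
    refine ⟨D.reroute _ hA hpoint harc,
      B.map φ hφ.continuous.continuousOn hφ.injective.injOn, φ '' F, ?_, ?_, ?_, ?_⟩
    · have := hF.map hφ.continuous.continuousOn hφ.injective.injOn
      rw [hσ0, ← hB0] at this
      exact this
    · rintro _ ⟨⟨y, hy, rfl⟩, hyD⟩
      change φ y = D.point b
      rw [← hσ0]
      rcases D.carrier_reroute_subset _ hA hpoint harc hyD with (⟨z, hz, hzy⟩ | h) | h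
      · rw [hφ.injective hzy] at hz
        rw [hRF ⟨hz, hy⟩]
      · rcases htail y h with h | h
        · exact absurd h (Set.disjoint_left.1 hFσ hy)
        · rw [hFC ⟨hy, h⟩]
      · rw [hFC ⟨hy, Or.inl h⟩]
    · rw [Drawing.carrier_map]
      rintro _ ⟨⟨y, hy, rfl⟩, z, hz, hzy⟩
      rw [hφ.injective hzy] at hz
      change φ y = φ (B.point 0)
      rw [(hBfree y hz).2.2.2 hy, hB0]
    · rw [Drawing.carrier_map, Set.disjoint_left]
      rintro _ ⟨y, hy, rfl⟩ hyD
      obtain ⟨h1, h2, h3, -⟩ := hBfree y hy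
      rcases D.carrier_reroute_subset _ hA hpoint harc hyD with (⟨z, hz, hzy⟩ | h) | h
      · exact h3 (hφ.injective hzy ▸ hz)
      · exact (htail y h).elim h2 h1
      · exact h1 (Or.inl h)
  -- An isolated vertex has a neighbourhood free of the rest of the drawing, so a straight segment
  -- in the chart is enough.
  · push Not at hb
    let K : Set X := D.point '' {b}ᶜ ∪ ⋃ e ∈ G.edgeSet, D.arc e
    have hKcl : IsClosed K := (toFinite _).isClosed.union
      ((toFinite G.edgeSet).isClosed_biUnion fun _ he => (D.isCompact_arc he).isClosed)
    have hbK : D.point b ∉ K := by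
      rintro (⟨w, hw, hwb⟩ | h)
      · exact hw (D.point_injective hwb)
      · obtain ⟨e, he, hbe⟩ := mem_iUnion₂.1 h
        have := D.mem_of_point_mem_arc e he b hbe
        obtain ⟨c, rfl⟩ := Sym2.mem_iff_exists.1 this
        exact hb c he
    have hDK : D.carrier ⊆ insert (D.point b) K := by
      rintro y (⟨w, rfl⟩ | hy)
      · by_cases h : w = b
        · exact Or.inl (h ▸ rfl)
        · exact Or.inr (Or.inl ⟨w, h, rfl⟩)
      · exact Or.inr (Or.inr hy)
    obtain ⟨ε, hε, hball⟩ := Metric.isOpen_iff.1 (hKcl.isOpen_compl.preimage hφ.continuous) 0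
      (show φ 0 ∉ K by rwa [hφ0])
    obtain ⟨w, hw, -⟩ := hE 0
    have hwpos := norm_pos_iff.2 hw
    let q := (ε / 2 / ‖w‖) • w
    have hqn : ‖q‖ = ε / 2 := by
      rw [norm_smul, Real.norm_of_nonneg (by positivity)]
      field_simp
    have hq : q ≠ 0 := by
      rw [← norm_pos_iff, hqn]
      positivity
    have hseg : segment ℝ 0 q ∩ φ ⁻¹' D.carrier ⊆ {0} := by
      rintro y ⟨hy, hyD⟩
      rcases hDK hyD with h | h
      · rw [← hφ0] at h
        exact hφ.injective h
      · refine absurd h (hball ?_)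
        refine (convex_ball (0 : EuclideanSpace ℝ (Fin 2)) ε).segment_subset
          (Metric.mem_ball_self hε) ?_ hy
        rw [mem_ball_zero_iff, hqn]
        linarith
    obtain ⟨B, hB0, -, hB1, hB2, -⟩ := exists_drawing_at_end_of_segment hE
      (D.isClosed_carrier.preimage hφ.continuous) hq hseg hε
    refine ⟨D, B.map φ hφ.continuous.continuousOn hφ.injective.injOn, φ '' segment ℝ 0 q,
      ?_, ?_, ?_, ?_⟩
    · have := (isArc_segment hq.symm).map hφ.continuous.continuousOn hφ.injective.injOn
      rw [hφ0, ← hB0] at this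
      rw [← hB0]
      exact this
    · rintro _ ⟨⟨y, hy, rfl⟩, hyD⟩
      rw [hseg ⟨hy, hyD⟩, hφ0]
      rfl
    · rw [Drawing.carrier_map]
      rintro _ ⟨⟨y, hy, rfl⟩, z, hz, hzy⟩
      rw [hφ.injective hzy] at hz
      change φ y = φ (B.point 0)
      rw [hB1 ⟨hy, hz⟩, hB0]
    · rw [Drawing.carrier_map, Set.disjoint_left]
      rintro _ ⟨y, hy, rfl⟩ hyD
      exact Set.disjoint_left.1 hB2 hy hyD

end Pendant

/-! ### Charts of the torus -/

/-- The line is shrunk onto the open interval of length 1 around `a`, on which the projection to the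
circle is injective. -/
theorem exists_isOpenEmbedding_real_unitAddCircle (x : UnitAddCircle) :
    ∃ φ : ℝ → UnitAddCircle, IsOpenEmbedding φ ∧ φ 0 = x := by
  obtain ⟨a, rfl⟩ := QuotientAddGroup.mk_surjective x
  let ψ : OpenPartialHomeomorph ℝ ℝ := OpenPartialHomeomorph.univBall a (1 / 2)
  have hψ : IsOpenEmbedding ψ := ψ.isOpenEmbedding (OpenPartialHomeomorph.univBall_source _ _)
  have hrange : ∀ y, ψ y ∈ (AddCircle.openPartialHomeomorphCoe (1 : ℝ) (a - 1 / 2)).source := by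
    intro y
    have := ψ.map_source (x := y) (by simp [ψ])
    rw [OpenPartialHomeomorph.univBall_target _ (by norm_num : (0 : ℝ) < 1 / 2),
      Real.ball_eq_Ioo] at this
    exact ⟨this.1, by linarith [this.2]⟩
  refine ⟨fun y => (ψ y : UnitAddCircle), ?_, ?_⟩
  · have h := (ψ.trans (AddCircle.openPartialHomeomorphCoe (1 : ℝ) (a - 1 / 2))).isOpenEmbedding
      (by
        rw [OpenPartialHomeomorph.trans_source, eq_univ_iff_forall]
        exact fun y => ⟨by simp [ψ], hrange y⟩)
    exact h
  · simp only [ψ, OpenPartialHomeomorph.univBall_apply_zero]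

theorem exists_isOpenEmbedding_plane_torus (x : Torus) :
    ∃ φ : EuclideanSpace ℝ (Fin 2) → Torus, IsOpenEmbedding φ ∧ φ 0 = x := by
  obtain ⟨φ, hφ, hφ0⟩ := exists_isOpenEmbedding_real_unitAddCircle x.1
  obtain ⟨ψ, hψ, hψ0⟩ := exists_isOpenEmbedding_real_unitAddCircle x.2
  let h : EuclideanSpace ℝ (Fin 2) ≃ₜ ℝ × ℝ :=
    (EuclideanSpace.equiv (Fin 2) ℝ).toHomeomorph.trans (Homeomorph.finTwoArrow (X := ℝ))
  refine ⟨Prod.map φ ψ ∘ h, (hφ.prodMap hψ).comp h.isOpenEmbedding, ?_⟩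
  have h0 : h 0 = (0, 0) := rfl
  simp [h0, hφ0, hψ0]

/-! ### Attaching a pendant graph -/

section Attach

variable {V X : Type*} [TopologicalSpace X] {G : SimpleGraph V}

theorem mem_edgeSet_sup_edge {S : Set V} (hS : ∀ u ∈ S, ∀ v ∉ S, ¬ G.Adj u v) {a b : V}
    {e : Sym2 V} (he : e ∈ (G ⊔ SimpleGraph.edge a b).edgeSet) :
    e = s(a, b) ∨ e ∈ G.edgeSet ∧ ((∀ v ∈ e, v ∈ S) ∨ ∀ v ∈ e, v ∉ S) := by
  induction e with | _ u v
  rw [SimpleGraph.mem_edgeSet, SimpleGraph.sup_adj, SimpleGraph.edge_adj] at he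
  rcases he with h | ⟨h, -⟩
  · refine Or.inr ⟨h, ?_⟩
    simp only [Sym2.mem_iff, forall_eq_or_imp, forall_eq]
    by_cases hu : u ∈ S <;> by_cases hv : v ∈ S
    · exact Or.inl ⟨hu, hv⟩
    · exact absurd h (hS u hu v hv)
    · exact absurd h.symm (hS v hv u hu)
    · exact Or.inr ⟨hu, hv⟩
  · left
    rcases h with ⟨rfl, rfl⟩ | ⟨rfl, rfl⟩
    · rfl
    · exact Sym2.eq_swap

/-- If a drawing has room for a pendant graph at the vertex `b`, then the part of `G` on a set `S`
of at most 4 vertices that is not joined to its complement can be redrawn there and joined to `b`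
by an edge. -/
theorem exists_drawing_sup_edge {D : Drawing G X} {b : V}
    {B : Drawing (⊤ : SimpleGraph (Fin 4)) X} {F : Set X} (h : IsPendant D b B F) {S : Set V}
    (hS : ∀ u ∈ S, ∀ v ∉ S, ¬ G.Adj u v) {ι : V → Fin 4} (hι : InjOn ι S) {a : V} (ha : a ∈ S)
    (ha0 : ι a = 0) (hb : b ∉ S) :
    ∃ D' : Drawing (G ⊔ SimpleGraph.edge a b) X, D'.arc s(a, b) = F ∧
      (∀ e ∈ G.edgeSet, (∀ v ∈ e, v ∈ S) → D'.arc e = B.arc (e.map ι) ∧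
        e.map ι ∈ (⊤ : SimpleGraph (Fin 4)).edgeSet) ∧
      (∀ e ∈ G.edgeSet, (∀ v ∈ e, v ∉ S) → D'.arc e = D.arc e) := by
  classical
  have hab : s(a, b) ∉ G.edgeSet := hS a ha b hb
  let point : V → X := fun v => if v ∈ S then B.point (ι v) else D.point v
  let arc : Sym2 V → Set X := fun e =>
    if e = s(a, b) then F else if ∀ v ∈ e, v ∈ S then B.arc (e.map ι) else D.arc e
  have point_in : ∀ {v}, v ∈ S → point v = B.point (ι v) := fun hv => if_pos hv
  have point_out : ∀ {v}, v ∉ S → point v = D.point v := fun hv => if_neg hv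
  have arc_ab : arc s(a, b) = F := if_pos rfl
  have arc_in : ∀ e ∈ G.edgeSet, (∀ v ∈ e, v ∈ S) → arc e = B.arc (e.map ι) := by
    intro e he heS
    have : e ≠ s(a, b) := fun h => hab (h ▸ he)
    simp only [arc, if_neg this, if_pos heS]
  have arc_out : ∀ e ∈ G.edgeSet, (∀ v ∈ e, v ∉ S) → arc e = D.arc e := by
    intro e he heS
    have : e ≠ s(a, b) := fun h => hab (h ▸ he)
    have h' : ¬ ∀ v ∈ e, v ∈ S := by
      induction e with | _ u v
      exact fun h => heS u (Sym2.mem_mk_left u v) (h u (Sym2.mem_mk_left u v))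
    simp only [arc, if_neg this, if_neg h']
  have hmap : ∀ e ∈ G.edgeSet, (∀ v ∈ e, v ∈ S) →
      e.map ι ∈ (⊤ : SimpleGraph (Fin 4)).edgeSet := by
    intro e he heS
    induction e with | _ u v
    exact hι.ne (heS u (Sym2.mem_mk_left u v)) (heS v (Sym2.mem_mk_right u v)) (G.ne_of_adj he)
  have hmem : ∀ e : Sym2 V, (∀ v ∈ e, v ∈ S) → ∀ w ∈ S, ι w ∈ e.map ι → w ∈ e := by
    intro e heS w hw hwe
    obtain ⟨v, hv, hvw⟩ := Sym2.mem_map.1 hwe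
    exact hι (heS v hv) hw hvw ▸ hv
  have hBD : ∀ {y}, y ∈ B.carrier → y ∉ D.carrier := fun hy => Set.disjoint_left.1 h.disjoint hy
  have hpa : point a = B.point 0 := by rw [point_in ha, ha0]
  have hpb : point b = D.point b := point_out hb
  refine ⟨⟨point, arc, ?_, ?_, ?_, ?_⟩, arc_ab,
    fun e he heS => ⟨arc_in e he heS, hmap e he heS⟩, arc_out⟩
  · intro u v huv
    by_cases hu : u ∈ S <;> by_cases hv : v ∈ S
    · rw [point_in hu, point_in hv] at huv
      exact hι hu hv (B.point_injective huv)
    · rw [point_in hu, point_out hv] at huv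
      exact absurd (huv ▸ D.point_mem_carrier v) (hBD (B.point_mem_carrier (ι u)))
    · rw [point_out hu, point_in hv] at huv
      exact absurd (huv ▸ D.point_mem_carrier u) (hBD (B.point_mem_carrier (ι v)))
    · rw [point_out hu, point_out hv] at huv
      exact D.point_injective huv
  · intro u v huv
    change IsArc _ _ _
    rcases mem_edgeSet_sup_edge hS (SimpleGraph.mem_edgeSet _ |>.2 huv) with he | ⟨he, heS | heS⟩
    · rw [he, arc_ab]
      rcases Sym2.eq_iff.1 he with ⟨rfl, rfl⟩ | ⟨rfl, rfl⟩
      · rw [hpa, hpb]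
        exact h.isArc.symm
      · rw [hpa, hpb]
        exact h.isArc
    · rw [arc_in _ he heS, point_in (heS u (Sym2.mem_mk_left u v)),
        point_in (heS v (Sym2.mem_mk_right u v))]
      exact B.isArc (hmap _ he heS)
    · rw [arc_out _ he heS, point_out (heS u (Sym2.mem_mk_left u v)),
        point_out (heS v (Sym2.mem_mk_right u v))]
      exact D.isArc he
  · intro e he w hw
    rcases mem_edgeSet_sup_edge hS he with rfl | ⟨he, heS | heS⟩
    · rw [arc_ab] at hw
      by_cases hwS : w ∈ S
      · rw [point_in hwS] at hw
        have h1 := B.point_injective (h.inter_right ⟨hw, B.point_mem_carrier _⟩)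
        rw [← ha0] at h1
        exact hι hwS ha h1 ▸ Sym2.mem_mk_left a b
      · rw [point_out hwS] at hw
        have h1 := D.point_injective (h.inter_left ⟨hw, D.point_mem_carrier _⟩)
        exact h1 ▸ Sym2.mem_mk_right a b
    · rw [arc_in e he heS] at hw
      by_cases hwS : w ∈ S
      · rw [point_in hwS] at hw
        exact hmem e heS w hwS (B.mem_of_point_mem_arc _ (hmap e he heS) _ hw)
      · rw [point_out hwS] at hw
        exact absurd (D.point_mem_carrier w) (hBD (B.arc_subset_carrier (hmap e he heS) hw))
    · rw [arc_out e he heS] at hw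
      by_cases hwS : w ∈ S
      · rw [point_in hwS] at hw
        exact absurd (D.arc_subset_carrier he hw) (hBD (B.point_mem_carrier _))
      · rw [point_out hwS] at hw
        exact D.mem_of_point_mem_arc _ he _ hw
  -- The relation is symmetric, which halves the mixed cases among the new edge, edges inside `S`
  -- and edges outside.
  · let Q : Sym2 V → Sym2 V → Prop := fun e f =>
      arc e ∩ arc f ⊆ point '' {w : V | w ∈ e ∧ w ∈ f}
    have hQ : ∀ e f, Q e f → Q f e := by
      intro e f h
      simpa only [Q, inter_comm, and_comm] using h
    have h1 : ∀ e ∈ G.edgeSet, (∀ v ∈ e, v ∈ S) → Q s(a, b) e := by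
      rintro e he heS y ⟨hy, hy'⟩
      rw [arc_ab] at hy
      rw [arc_in e he heS] at hy'
      have hy0 : y = B.point 0 := h.inter_right ⟨hy, B.arc_subset_carrier (hmap e he heS) hy'⟩
      rw [hy0] at hy'
      refine ⟨a, ⟨Sym2.mem_mk_left a b, hmem e heS a ha ?_⟩, hpa.trans hy0.symm⟩
      rw [ha0]
      exact B.mem_of_point_mem_arc _ (hmap e he heS) _ hy'
    have h2 : ∀ e ∈ G.edgeSet, (∀ v ∈ e, v ∉ S) → Q s(a, b) e := by
      rintro e he heS y ⟨hy, hy'⟩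
      rw [arc_ab] at hy
      rw [arc_out e he heS] at hy'
      have hy0 : y = D.point b := h.inter_left ⟨hy, D.arc_subset_carrier he hy'⟩
      rw [hy0] at hy'
      exact ⟨b, ⟨Sym2.mem_mk_right a b, D.mem_of_point_mem_arc _ he _ hy'⟩, hpb.trans hy0.symm⟩
    have h3 : ∀ e ∈ G.edgeSet, ∀ f ∈ G.edgeSet, (∀ v ∈ e, v ∈ S) → (∀ v ∈ f, v ∉ S) → Q e f := by
      rintro e he f hf heS hfS y ⟨hy, hy'⟩
      rw [arc_in e he heS] at hy
      rw [arc_out f hf hfS] at hy'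
      exact absurd (D.arc_subset_carrier hf hy') (hBD (B.arc_subset_carrier (hmap e he heS) hy))
    intro e he f hf hne
    change Q e f
    rcases mem_edgeSet_sup_edge hS he with rfl | ⟨he, heS | heS⟩ <;>
      rcases mem_edgeSet_sup_edge hS hf with rfl | ⟨hf, hfS | hfS⟩
    · exact absurd rfl hne
    · exact h1 f hf hfS
    · exact h2 f hf hfS
    · exact hQ _ _ (h1 e he heS)
    · rintro y ⟨hy, hy'⟩
      rw [arc_in e he heS] at hy
      rw [arc_in f hf hfS] at hy'
      have hne' : e.map ι ≠ f.map ι := by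
        intro heq
        refine hne (Sym2.ext fun w => ⟨fun hw => hmem f hfS w (heS w hw) ?_,
          fun hw => hmem e heS w (hfS w hw) ?_⟩)
        · exact heq ▸ Sym2.mem_map.2 ⟨w, hw, rfl⟩
        · exact heq ▸ Sym2.mem_map.2 ⟨w, hw, rfl⟩
      obtain ⟨i, ⟨hi, hi'⟩, rfl⟩ :=
        B.arc_inter_arc _ (hmap e he heS) _ (hmap f hf hfS) hne' ⟨hy, hy'⟩
      obtain ⟨w, hw, rfl⟩ := Sym2.mem_map.1 hi
      exact ⟨w, ⟨hw, hmem f hfS w (heS w hw) hi'⟩, point_in (heS w hw)⟩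
    · exact h3 e he f hf heS hfS
    · exact hQ _ _ (h2 e he heS)
    · exact hQ _ _ (h3 f hf e he hfS heS)
    · rintro y ⟨hy, hy'⟩
      rw [arc_out e he heS] at hy
      rw [arc_out f hf hfS] at hy'
      obtain ⟨w, ⟨hw, hw'⟩, rfl⟩ := D.arc_inter_arc e he f hf hne ⟨hy, hy'⟩
      exact ⟨w, ⟨hw, hw'⟩, point_out (heS w hw)⟩

end Attach

/-! ### Polygonal drawings in space -/

theorem isPolygonal_segment (x y : Space) : IsPolygonal (segment ℝ x y) :=
  ⟨{(x, y)}, by simp⟩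

/-- The vectors `(1, t, 0)` are nonzero and pairwise non-parallel. If each were a multiple of an
element of `L`, two would share that element. -/
theorem exists_ne_smul_of_finite {L : Set Space} (hL : L.Finite) :
    ∃ v : Space, v ≠ 0 ∧ ∀ l ∈ L, ∀ c : ℝ, v ≠ c • l := by
  by_contra! hcon
  have hv : ∀ t : ℝ, (!₂[1, t, 0] : Space) ≠ 0 := fun t h => by
    simpa using congrFun (congrArg WithLp.ofLp h) 0
  choose l hl c hc using fun t => hcon _ (hv t)
  have : Finite L := hL
  obtain ⟨s, t, hst, hlst⟩ := Finite.exists_ne_map_eq_of_infinite fun t => (⟨l t, hl t⟩ : L)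
  have hls : l s = l t := congrArg Subtype.val hlst
  have h0 : ∀ t, 1 = c t * l t 0 := fun t => by
    simpa using congrFun (congrArg WithLp.ofLp (hc t)) 0
  have h1 : ∀ t, t = c t * l t 1 := fun t => by
    simpa using congrFun (congrArg WithLp.ofLp (hc t)) 1
  have h2 := h0 s
  have h3 := h1 s
  rw [hls] at h2 h3
  have hcst : c s = c t := by
    have hne : l t 0 ≠ 0 := fun h => by simpa [h] using h0 t
    exact mul_right_cancel₀ hne (h2.symm.trans (h0 t))
  exact hst (by rw [h3, hcst, ← h1 t])

/-- A polygonal drawing in space has room for a small pendant graph at any vertex. -/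
theorem exists_isPendant_space {V : Type*} [Finite V] {G : SimpleGraph V} (D : Drawing G Space)
    (hD : ∀ e ∈ G.edgeSet, IsPolygonal (D.arc e)) (b : V) :
    ∃ (B : Drawing (⊤ : SimpleGraph (Fin 4)) Space) (q : Space) (δ : ℝ),
      IsPendant D b B (segment ℝ (D.point b) q) ∧ (∀ e, IsPolygonal (B.arc e)) ∧ 0 < δ ∧
      B.carrier ⊆ Metric.ball q δ ∧ Disjoint D.carrier (Metric.closedBall q δ) := by
  have hE : ∀ v : Space, ∃ w ≠ 0, inner ℝ v w = 0 := exists_ne_zero_inner_eq_zero (by simp)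
  choose! P hP using hD
  obtain ⟨v, hv, hvP⟩ := exists_ne_smul_of_finite
    ((toFinite G.edgeSet).biUnion fun e _ => (P e).finite_toSet.image fun p => p.2 - p.1)
  have hcont : Continuous fun t : ℝ => D.point b + t • v := by fun_prop
  have hfree : ∀ C : Set Space, IsClosed C → D.point b ∉ C →
      ∀ᶠ t in 𝓝[>] (0 : ℝ), D.point b + t • v ∉ C := by
    intro C hC hbC
    refine (hcont.continuousAt.eventually (hC.isOpen_compl.mem_nhds ?_)).filter_mono
      nhdsWithin_le_nhds
    simpa using hbC
  have hev : ∀ᶠ t in 𝓝[>] (0 : ℝ), D.point b + t • v ∉ D.carrier := by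
    have h1 : ∀ᶠ t in 𝓝[>] (0 : ℝ), ∀ w, D.point b + t • v ≠ D.point w := by
      refine eventually_all.2 fun w => ?_
      by_cases hw : w = b
      · filter_upwards [self_mem_nhdsWithin] with t ht
        rw [hw, ne_eq, add_eq_left]
        exact smul_ne_zero (ne_of_gt ht) hv
      · exact hfree {D.point w} isClosed_singleton fun h => hw (D.point_injective h).symm
    have h2 : ∀ᶠ t in 𝓝[>] (0 : ℝ), ∀ e ∈ G.edgeSet, ∀ p ∈ P e,
        D.point b + t • v ∉ segment ℝ p.1 p.2 := by
      refine (eventually_all_finite (toFinite _)).2 fun e he =>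
        (eventually_all_finset _).2 fun p hp => ?_
      -- A segment through `D.point b` that met the ray again would make `v` a multiple of its
      -- direction. A segment not through `D.point b` is closed, so the start of the ray avoids it.
      by_cases hbp : D.point b ∈ segment ℝ p.1 p.2
      · filter_upwards [self_mem_nhdsWithin] with t ht hmem
        rw [segment_eq_image'] at hbp hmem
        obtain ⟨α, -, hα⟩ := hbp
        obtain ⟨β, -, hβ⟩ := hmem
        have h3 : t • v = (β - α) • (p.2 - p.1) := by
          rw [← hα] at hβ
          linear_combination (norm := module) -hβ
        refine hvP (p.2 - p.1) (mem_iUnion₂.2 ⟨e, he, p, hp, rfl⟩) (t⁻¹ * (β - α)) ?_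
        rw [mul_smul, ← h3, inv_smul_smul₀ (ne_of_gt ht)]
      · refine hfree _ ?_ hbp
        by_cases hpp : p.1 = p.2
        · rw [hpp, segment_same]
          exact isClosed_singleton
        · exact (isArc_segment hpp).isCompact.isClosed
    filter_upwards [h1, h2] with t h1 h2
    rintro (⟨w, hw⟩ | hmem)
    · exact h1 w hw.symm
    · obtain ⟨e, he, hmem⟩ := mem_iUnion₂.1 hmem
      rw [hP e he] at hmem
      obtain ⟨p, hp, hmem⟩ := mem_iUnion₂.1 hmem
      exact h2 e he p hp hmem
  obtain ⟨ε, hε, hεsub⟩ := mem_nhdsGT_iff_exists_Ioc_subset.1 hev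
  have hε' : 0 < ε := hε
  set q := D.point b + ε • v with hq
  have hqb : q ≠ D.point b := by
    rw [hq, ne_eq, add_eq_left]
    exact smul_ne_zero hε'.ne' hv
  have hseg : segment ℝ (D.point b) q ∩ D.carrier ⊆ {D.point b} := by
    rintro y ⟨hy, hyD⟩
    rw [segment_eq_image'] at hy
    obtain ⟨t, ht, rfl⟩ := hy
    rcases ht.1.eq_or_lt with rfl | h0
    · simp
    · change D.point b + t • (q - D.point b) ∈ D.carrier at hyD
      rw [hq, add_sub_cancel_left, smul_smul] at hyD
      exact absurd hyD (hεsub ⟨mul_pos h0 hε', mul_le_of_le_one_left hε'.le ht.2⟩)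
  have hqD : q ∉ D.carrier := hεsub ⟨hε', le_rfl⟩
  obtain ⟨δ, hδ, hball⟩ := Metric.isOpen_iff.1 D.isClosed_carrier.isOpen_compl q hqD
  obtain ⟨B, hB0, hBseg, hB1, hB2, hB3⟩ := exists_drawing_at_end_of_segment hE D.isClosed_carrier
    hqb hseg (half_pos hδ)
  refine ⟨B, q, δ / 2, ⟨by rw [hB0]; exact isArc_segment hqb.symm, hseg,
    by rw [hB0]; exact hB1, hB2⟩, ?_, half_pos hδ,
    hB3, ?_⟩
  · intro e
    obtain ⟨x, y, hxy⟩ := hBseg e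
    exact hxy ▸ isPolygonal_segment x y
  · rw [Set.disjoint_left]
    intro y hy hyq
    exact hball (Metric.closedBall_subset_ball (half_lt_self hδ) hyq) hy

theorem sphereEncloses_of_ball {K L : Set Space} {q : Space} {δ : ℝ} (hδ : 0 < δ)
    (hK : K ⊆ Metric.ball q δ) (hL : Disjoint L (Metric.closedBall q δ)) : SphereEncloses K L := by
  refine ⟨(Homeomorph.smulOfNeZero δ hδ.ne').trans (Homeomorph.addLeft q), fun y hy => ?_,
    fun y hy => ?_⟩
  · refine ⟨δ⁻¹ • (y - q), ?_, ?_⟩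
    · have h1 := mem_ball_iff_norm.1 (hK hy)
      rw [mem_ball_zero_iff, norm_smul, norm_inv, Real.norm_of_nonneg hδ.le, inv_mul_lt_one₀ hδ]
      exact h1
    · change q + δ • (δ⁻¹ • (y - q)) = y
      rw [smul_inv_smul₀ hδ.ne', add_sub_cancel]
  · rintro ⟨z, hz, rfl⟩
    refine Set.disjoint_left.1 hL hy ?_
    change q + δ • z ∈ _
    rw [mem_closedBall_zero_iff] at hz
    rw [mem_closedBall_iff_norm, add_sub_cancel_left, norm_smul, Real.norm_of_nonneg hδ.le]
    nlinarith

/-! ### Walks and cycles in a graph with a separated vertex set -/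

section Graphs

variable {V : Type*} {G : SimpleGraph V} {S : Set V}

theorem mem_of_reachable (hS : ∀ u ∈ S, ∀ v ∉ S, ¬ G.Adj u v) {u v : V} (h : G.Reachable u v)
    (hu : u ∈ S) : v ∈ S := by
  obtain ⟨p⟩ := h
  induction p with
  | nil => exact hu
  | cons hadj _ ih =>
    refine ih ?_
    by_contra hcon
    exact hS _ hu _ hcon hadj

theorem support_subset_or_disjoint (hS : ∀ u ∈ S, ∀ v ∉ S, ¬ G.Adj u v) {u v : V}
    (p : G.Walk u v) : (∀ w ∈ p.support, w ∈ S) ∨ ∀ w ∈ p.support, w ∉ S := by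
  classical
  by_cases hu : u ∈ S
  · exact Or.inl fun w hw => mem_of_reachable hS ⟨p.takeUntil w hw⟩ hu
  · exact Or.inr fun w hw hwS => hu (mem_of_reachable hS ⟨(p.takeUntil w hw).reverse⟩ hwS)

/-- An edge between two parts not joined by other edges lies on no cycle. -/
theorem notMem_edges_of_isCycle (hS : ∀ u ∈ S, ∀ v ∉ S, ¬ G.Adj u v) {a b : V} (ha : a ∈ S)
    (hb : b ∉ S) {u : V} (c : (G ⊔ SimpleGraph.edge a b).Walk u u) (hc : c.IsCycle) :
    s(a, b) ∉ c.edges := by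
  have hab : a ≠ b := fun h => hb (h ▸ ha)
  have he : s(a, b) ∈ (G ⊔ SimpleGraph.edge a b).edgeSet := by
    simp [hab]
  refine (SimpleGraph.isBridge_iff_forall_cycle_notMem he).1 ?_ c hc
  rw [SimpleGraph.isBridge_iff]
  intro h
  refine hb (mem_of_reachable (fun u hu v hv huv => ?_) h ha)
  rw [SimpleGraph.deleteEdges_adj] at huv
  rcases mem_edgeSet_sup_edge hS (SimpleGraph.mem_edgeSet _ |>.2 huv.1) with h | ⟨h, -⟩
  · exact huv.2 h
  · exact hS u hu v hv h

/-- Dropping the repeated base vertex leaves two disjoint lists without repetition, each of length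
at least 3. -/
theorem six_le_card_of_isCycle {S : Finset V} {u v : V} {c : G.Walk u u} {d : G.Walk v v}
    (hc : c.IsCycle) (hd : d.IsCycle) (hcd : c.support.Disjoint d.support)
    (hcS : ∀ w ∈ c.support, w ∈ S) (hdS : ∀ w ∈ d.support, w ∈ S) : 6 ≤ S.card := by
  classical
  have hnodup : (c.support.tail ++ d.support.tail).Nodup :=
    List.Nodup.append hc.support_nodup hd.support_nodup fun w hw hw' =>
      hcd (List.mem_of_mem_tail hw) (List.mem_of_mem_tail hw')
  have hsub : (c.support.tail ++ d.support.tail).toFinset ⊆ S := by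
    intro w hw
    rw [List.mem_toFinset, List.mem_append] at hw
    exact hw.elim (fun h => hcS w (List.mem_of_mem_tail h))
      fun h => hdS w (List.mem_of_mem_tail h)
  have := Finset.card_le_card hsub
  rw [List.toFinset_card_of_nodup hnodup, List.length_append, List.length_tail, List.length_tail,
    SimpleGraph.Walk.length_support, SimpleGraph.Walk.length_support] at this
  have := hc.three_le_length
  have := hd.three_le_length
  omega

end Graphs

/-- A numbering of a set of at most 4 vertices starting with a given one. -/
theorem exists_injOn_fin_four {V : Type*} {S : Finset V} (hS : S.card ≤ 4) {a : V} (ha : a ∈ S) :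
    ∃ ι : V → Fin 4, InjOn ι S ∧ ι a = 0 := by
  classical
  obtain ⟨f⟩ := Function.Embedding.nonempty_of_card_le (α := S) (β := Fin 4) (by simpa using hS)
  refine ⟨fun v => if h : v ∈ S then Equiv.swap (f ⟨a, ha⟩) 0 (f ⟨v, h⟩) else 0, ?_, ?_⟩
  · intro u hu v hv huv
    rw [Finset.mem_coe] at hu hv
    simp only [dif_pos hu, dif_pos hv] at huv
    exact congrArg Subtype.val (f.injective ((Equiv.swap _ _).injective huv))
  · simp [ha]

/-! ### Adding an edge preserves toroidality and linklessness -/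

section Main

variable {V : Type*} {G : SimpleGraph V} {S : Finset V}

theorem isPlanar_induce_of_card_le_four (hS : S.card ≤ 4) {a : V} (ha : a ∈ S) :
    IsPlanar (G.induce (S : Set V)) := by
  obtain ⟨ι, hι, -⟩ := exists_injOn_fin_four hS ha
  have hinj : Function.Injective fun v : (S : Set V) => ι v := fun u v huv =>
    Subtype.ext (hι u.2 v.2 huv)
  exact ⟨tetraDrawing.comap
    (⟨fun v => ι v, fun h => hinj.ne (SimpleGraph.ne_of_adj _ h)⟩ :
      G.induce (S : Set V) →g (⊤ : SimpleGraph (Fin 4))) hinj⟩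

theorem isToroidal_sup_edge [Finite V] (hG : IsToroidal G) (hcard : S.card ≤ 4)
    (hS : ∀ a ∈ S, ∀ b ∉ S, ¬ G.Adj a b) {a b : V} (ha : a ∈ S) (hb : b ∉ S) :
    IsToroidal (G ⊔ SimpleGraph.edge a b) := by
  obtain ⟨D⟩ := hG
  obtain ⟨ι, hι, hι0⟩ := exists_injOn_fin_four hcard ha
  obtain ⟨D', B, F, h⟩ := exists_isPendant exists_isOpenEmbedding_plane_torus D b
  obtain ⟨D'', -⟩ := exists_drawing_sup_edge h (S := (S : Set V)) hS hι ha hι0 hb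
  exact ⟨D''⟩

theorem isNIL_sup_edge [Finite V] (hG : IsNIL G) (hcard : S.card ≤ 4)
    (hS : ∀ a ∈ S, ∀ b ∉ S, ¬ G.Adj a b) {a b : V} (ha : a ∈ S) (hb : b ∉ S) :
    IsNIL (G ⊔ SimpleGraph.edge a b) := by
  obtain ⟨D, hD, hlink⟩ := hG
  obtain ⟨ι, hι, hι0⟩ := exists_injOn_fin_four hcard ha
  obtain ⟨B, q, δ, h, hB, hδ, hBq, hDq⟩ := exists_isPendant_space D hD b
  have hS' : ∀ u ∈ (S : Set V), ∀ v ∉ (S : Set V), ¬ G.Adj u v := hS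
  obtain ⟨D', hF, hin, hout⟩ := exists_drawing_sup_edge h hS' hι ha hι0 hb
  refine ⟨D', fun e he => ?_, fun u v c d hc hd hcd => ?_⟩
  · rcases mem_edgeSet_sup_edge hS' he with rfl | ⟨he, heS | heS⟩
    · rw [hF]
      exact isPolygonal_segment _ _
    · rw [(hin e he heS).1]
      exact hB _
    · rw [hout e he heS]
      exact hD e he
  -- cycles of the larger graph are cycles of `G`
  have hcycle : ∀ {u : V} (c : (G ⊔ SimpleGraph.edge a b).Walk u u), c.IsCycle →
      ∃ c' : G.Walk u u, c'.IsCycle ∧ c'.edges = c.edges ∧ c'.support = c.support := by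
    intro u c hc
    have hmem : ∀ e ∈ c.edges, e ∈ G.edgeSet := by
      intro e he
      rcases mem_edgeSet_sup_edge hS' (c.edges_subset_edgeSet he) with rfl | ⟨h, -⟩
      · exact absurd he (notMem_edges_of_isCycle hS' ha hb c hc)
      · exact h
    exact ⟨c.transfer G hmem, hc.transfer hmem, c.edges_transfer hmem, c.support_transfer hmem⟩
  obtain ⟨c', hc', hce, hcs⟩ := hcycle c hc
  obtain ⟨d', hd', hde, hds⟩ := hcycle d hd
  have hcurve : ∀ {u : V} (c : (G ⊔ SimpleGraph.edge a b).Walk u u) (c' : G.Walk u u),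
      c'.edges = c.edges → (∀ w ∈ c'.support, w ∉ (S : Set V)) → D'.curve c = D.curve c' := by
    intro u c c' hce hcS
    rw [Drawing.curve, Drawing.curve, ← hce]
    refine iUnion₂_congr fun e he => hout e (c'.edges_subset_edgeSet he) fun w hw => ?_
    exact hcS w (c'.mem_support_of_mem_edges he hw)
  have hcurve_sub : ∀ {u : V} (c' : G.Walk u u), D.curve c' ⊆ D.carrier := fun c' =>
    iUnion₂_subset fun e he => D.arc_subset_carrier (c'.edges_subset_edgeSet he)
  have hcurve_in : ∀ {u : V} (c : (G ⊔ SimpleGraph.edge a b).Walk u u) (c' : G.Walk u u),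
      c'.edges = c.edges → (∀ w ∈ c'.support, w ∈ (S : Set V)) →
      D'.curve c ⊆ Metric.ball q δ := by
    intro u c c' hce hcS
    rw [Drawing.curve, ← hce]
    refine iUnion₂_subset fun e he => ?_
    obtain ⟨h1, h2⟩ := hin e (c'.edges_subset_edgeSet he) fun w hw =>
      hcS w (c'.mem_support_of_mem_edges he hw)
    rw [h1]
    exact (B.arc_subset_carrier h2).trans hBq
  -- Both cycles in `S` would need six vertices; one inside and one outside are split by the sphere
  -- around `q`; two outside have kept their old curves.
  rcases support_subset_or_disjoint hS' c' with hcS | hcS <;>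
    rcases support_subset_or_disjoint hS' d' with hdS | hdS
  · have := six_le_card_of_isCycle hc' hd' (by rwa [hcs, hds]) hcS hdS
    omega
  · left
    rw [hcurve d d' hde hdS]
    exact sphereEncloses_of_ball hδ (hcurve_in c c' hce hcS) (hDq.mono_left (hcurve_sub d'))
  · right
    rw [hcurve c c' hce hcS]
    exact sphereEncloses_of_ball hδ (hcurve_in d d' hde hdS) (hDq.mono_left (hcurve_sub c'))
  · rw [hcurve c c' hce hcS, hcurve d d' hde hdS]
    exact hlink u v c' d' hc' hd' (by rwa [hcs, hds])

theorem isTN_sup_edge [Finite V] (hG : IsTN G) (hcard : S.card ≤ 4)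
    (hS : ∀ a ∈ S, ∀ b ∉ S, ¬ G.Adj a b) {a b : V} (ha : a ∈ S) (hb : b ∉ S) :
    IsTN (G ⊔ SimpleGraph.edge a b) :=
  ⟨isToroidal_sup_edge hG.1 hcard hS ha hb, isNIL_sup_edge hG.2 hcard hS ha hb⟩

/-- A disconnected graph of order 9 has a nonempty set of at most 4 vertices that is not joined to
its complement. -/
theorem exists_finset_of_not_connected [Fintype V] (hV : Fintype.card V = 9)
    (hG : ¬ G.Connected) : ∃ S : Finset V, S.Nonempty ∧ S.card ≤ 4 ∧
      ∀ a ∈ S, ∀ b ∉ S, ¬ G.Adj a b := by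
  classical
  have : Nonempty V := Fintype.card_pos_iff.1 (by omega)
  obtain ⟨u, v, huv⟩ : ∃ u v, ¬ G.Reachable u v := by
    by_contra! hcon
    exact hG ⟨hcon⟩
  let S : Finset V := Finset.univ.filter (G.Reachable u)
  have hmem : ∀ {w}, w ∈ S ↔ G.Reachable u w := by simp [S]
  have hS : ∀ a ∈ S, ∀ b ∉ S, ¬ G.Adj a b := fun a ha b hb hab =>
    hb (hmem.2 ((hmem.1 ha).trans hab.reachable))
  have hsum := S.card_add_card_compl
  rw [hV] at hsum
  -- As 9 = 4 + 5, the component of `u` or its complement has at most four vertices.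
  rcases le_or_gt S.card 4 with h | h
  · exact ⟨S, ⟨u, hmem.2 (SimpleGraph.Reachable.refl u)⟩, h, hS⟩
  · refine ⟨Sᶜ, ⟨v, Finset.mem_compl.2 fun h => huv (hmem.1 h)⟩, by omega, fun a ha b hb hab => ?_⟩
    rw [Finset.mem_compl] at ha hb
    exact hS b (not_not.1 hb) a ha hab.symm

theorem exists_notMem_of_card_le_four [Fintype V] (hV : Fintype.card V = 9)
    (hS : S.card ≤ 4) : ∃ b, b ∉ S := by
  by_contra! hcon
  have := Finset.card_le_card (fun v _ => hcon v : Finset.univ ⊆ S)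
  rw [Finset.card_univ] at this
  omega

end Main

end SpatialGraph

theorem mainTheorem8 {V : Type*} [Fintype V] (hV : Fintype.card V = 9) (G : SimpleGraph V) :
    (SpatialGraph.IsMTN G → G.Connected) ∧
    (SpatialGraph.IsTN G → ∀ S : Finset V, S.Nonempty → S.card ≤ 4 →
      (∀ a ∈ S, ∀ b ∉ S, ¬ G.Adj a b) →
      SpatialGraph.IsPlanar (G.induce (S : Set V)) ∧
      ∃ a ∈ S, ∃ b ∉ S, SpatialGraph.IsTN (G ⊔ SimpleGraph.edge a b)) := by
  constructor
  · intro hG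
    by_contra hcon
    obtain ⟨S, ⟨a, ha⟩, hcard, hS⟩ := SpatialGraph.exists_finset_of_not_connected hV hcon
    obtain ⟨b, hb⟩ := SpatialGraph.exists_notMem_of_card_le_four hV hcard
    exact hG.2 a b (fun h => hb (h ▸ ha)) (hS a ha b hb)
      (SpatialGraph.isTN_sup_edge hG.1 hcard hS ha hb)
  · rintro hG S ⟨a, ha⟩ hcard hS
    obtain ⟨b, hb⟩ := SpatialGraph.exists_notMem_of_card_le_four hV hcard
    exact ⟨SpatialGraph.isPlanar_induce_of_card_le_four hcard ha, a, ha, b, hb,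
      SpatialGraph.isTN_sup_edge hG hcard hS ha hb⟩
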